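/- For $x\in\mathbb{R}$ let $\|x\|$ be the distance from $x$ to the nearest integer. Call a pair $(\gamma,\beta)$ of real numbers Diophantine if $\gamma,\beta$ are linearly independent over $\mathbb{Q}$ and there are $\rho,c>0$ such that $\|m\gamma+n\beta\|\ge c\,\max\{|m|,|n|\}^{-\rho}$ for all $(m,n)\in\mathbb{Z}^2\setminus\{(0,0)\}$. For $\psi:\mathbb{N}\to[0,\infty)$, where $\mathbb{N}=\{1,2,\dots\}$, and $\beta,\gamma,\gamma'\in\mathbb{R}$ put $$W(\psi,\beta,\gamma,\gamma')=\{x\in[0,1]:\ \|qx-\gamma\|\,\|q\beta-\gamma'\|<\psi(q)\ \text{for infinitely many } q\in\mathbb{N}\}.$$ **Theorem 1.2.** Let $\psi:\mathbb{N}\to[0,\infty)$ be non-increasing with $\sum_{q=1}^\infty\psi(q)\log q=\infty$. Let $\gamma,\beta$ be irrational numbers such that the pair $(\gamma,\beta)$ is Diophantine, and let $\gamma'$ be any real number. Then $W(\psi,\beta,\gamma,\gamma')$ has full Lebesgue measure in $[0,1]$, i.e. $|W(\psi,\beta,\gamma,\gamma')|=1$. -/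

import Mathlib

noncomputable section

/-- The distance `‖x‖` from a real number `x` to the set of integers. -/
def distInt (x : ℝ) : ℝ := |x - (round x : ℝ)|

/-- `distInt x` is the metric distance from `x` to the set `ℤ ⊆ ℝ`. -/
theorem distInt_eq_infDist (x : ℝ) :
    distInt x = Metric.infDist x (Set.range (fun n : ℤ => (n : ℝ))) := by
  apply le_antisymm
  · refine (Metric.le_infDist (Set.range_nonempty _)).2 ?_
    rintro _ ⟨n, rfl⟩
    rw [Real.dist_eq]
    exact round_le x n
  · have h := Metric.infDist_le_dist_of_mem (x := x)
      (Set.mem_range_self (f := fun n : ℤ => (n : ℝ)) (round x))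
    rwa [Real.dist_eq] at h

/-- The pair `(γ, β)` is Diophantine: `γ, β` are linearly independent over `ℚ`, and there are
`ρ, c > 0` with `‖m γ + n β‖ ≥ c max(|m|, |n|)^{-ρ}` for all integers `m, n`, not both zero. -/
def IsDiophantinePair (γ β : ℝ) : Prop :=
  LinearIndependent ℚ ![γ, β] ∧
    ∃ ρ c : ℝ, 0 < ρ ∧ 0 < c ∧ ∀ m n : ℤ, (m ≠ 0 ∨ n ≠ 0) →
      c * (max |(m : ℝ)| |(n : ℝ)|) ^ (-ρ) ≤ distInt (m * γ + n * β)

/-- The set `W(ψ, β, γ, γ')` of all `x ∈ [0, 1]` such that `‖q x - γ‖ ‖q β - γ'‖ < ψ(q)` for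
infinitely many positive integers `q`. -/
def fibredSet (ψ : ℕ → ℝ) (β γ γ' : ℝ) : Set ℝ :=
  {x | x ∈ Set.Icc (0 : ℝ) 1 ∧
    {q : ℕ | 1 ≤ q ∧ distInt (q * x - γ) * distInt (q * β - γ') < ψ q}.Infinite}

end

/-! The proof is a second-moment Borel–Cantelli argument on the circle. Cut the integers into blocks
`2 ^ (K t) ≤ q < 2 ^ (K (t + 1))` and replace `ψ` on each block by a constant `φ t`: its value at
the right endpoint, capped at `2 ^ (-K t)`. Keep only those `q` for which `‖q β - γ'‖` lies between
`2 ^ (-5 t)` and `2 ^ (-4 t)`, and give them the radius `δ q = φ t / ‖q β - γ'‖`. It then suffices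
that almost every `x` satisfies `‖q x - γ‖ < δ q` infinitely often.

Mean: the Diophantine bound makes the multiples of `β` equidistribute at scales down to a power of
`2 ^ (-t)`, so each of the `t` dyadic levels of `‖q β - γ'‖` contributes at least `2 ^ (K t) φ t /
16` to the sum of radii (`sum_radius_block_ge`). These `t` levels supply the logarithm, and
condensation gives divergence (`not_summable_condensed`).

Variance: for `q < r` the sets for `q` and `r` are independent up to an error `2 gcd(q, r) δ r / r`
(`volume_nearSet_inter_le`), which is needed only when they meet. For a fixed gcd `g` and `r` in
block `t`, the number of meeting pairs is smaller than trivial by a factor of order `2 ^ (-6 t)`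
(`card_overlapping_le`). If `g` is small, this is because both `q β` and `r β` must be close to
`γ'`. If `g` is large, the two conditions on `x` force `((r - q) / g) γ` very near an integer, which
is rare because `γ` is badly approximable to a power. Since `δ r ≤ 2 ^ (5 t - K t)`, a factor `2 ^
(-t)` survives the sum over `g`, and the total error is bounded. The variance is therefore at most
linear in the mean, and Chebyshev's inequality finishes (`ae_infinite_of_sum_inter_le`). -/

/-! ### Visits of a circle rotation to small balls. -/

section Counting

open scoped Classical

/-- If the multiples `j h α`, `1 ≤ j < J`, all have norm at least `2 w`, then the translates by
`0, h, 2 h, …` of the visiting times of a ball of radius `w` are disjoint. -/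
theorem mul_card_visits_le {E : Type*} [SeminormedAddCommGroup E] (α y : E) (w : ℝ) (N h J : ℕ)
    (hsep : ∀ j : ℕ, 1 ≤ j → j < J → 2 * w ≤ ‖(j * h) • α‖) :
    J * ((Finset.Icc 1 N).filter (fun n : ℕ => ‖n • α - y‖ < w)).card ≤ N + J * h := by
  set Z := (Finset.Icc 1 N).filter (fun n : ℕ => ‖n • α - y‖ < w) with hZ
  have key : ∀ n ∈ Z, ∀ n' ∈ Z, ∀ j j' : ℕ, j' < J → j < j' →
      n + j * h = n' + j' * h → False := by
    intro n hn n' hn' j j' hj' hjj he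
    rw [hZ, Finset.mem_filter] at hn hn'
    have h1 := hsep (j' - j) (by omega) (by omega)
    have h2 : n = n' + (j' - j) * h := by
      obtain ⟨d, rfl⟩ := Nat.exists_eq_add_of_lt hjj
      have : j + d + 1 - j = d + 1 := by omega
      rw [this]
      nlinarith
    have h3 : ((j' - j) * h) • α = (n • α - y) - (n' • α - y) := by
      rw [h2, add_smul]; abel
    rw [h3] at h1
    have := norm_sub_le (n • α - y) (n' • α - y)
    linarith [hn.2, hn'.2]
  have hcard : (Finset.range J ×ˢ Z).card ≤ (Finset.Icc 1 (N + J * h)).card := by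
    refine Finset.card_le_card_of_injOn (fun p => p.2 + p.1 * h) ?_ ?_
    · rintro ⟨j, n⟩ hp
      simp only [Finset.coe_product, Set.mem_prod, Finset.mem_coe, Finset.mem_range] at hp
      have hn := (Finset.mem_Icc.1 (Finset.mem_filter.1 hp.2).1)
      have : j * h ≤ J * h := Nat.mul_le_mul_right _ hp.1.le
      simp only [Finset.mem_coe, Finset.mem_Icc]
      omega
    · rintro ⟨j, n⟩ hp ⟨j', n'⟩ hp' he
      simp only [Finset.coe_product, Set.mem_prod, Finset.mem_coe, Finset.mem_range] at hp hp'
      simp only at he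
      rcases lt_trichotomy j j' with hlt | rfl | hlt
      · exact (key n hp.2 n' hp'.2 j j' hp'.1 hlt he).elim
      · simp only [Prod.mk.injEq, true_and]; omega
      · exact (key n' hp'.2 n hp.2 j' j hp.1 hlt he.symm).elim
  simpa using hcard

/-- If the points `z, z + h α, …, z + (J - 1) h α` always meet the ball of radius `w`, then the
visiting times of such a ball have density at least `1 / J`. -/
theorem le_mul_card_visits {E : Type*} [SeminormedAddCommGroup E] (α y : E) (w : ℝ)
    (X N h J : ℕ) (hcov : ∀ z : E, ∃ j < J, ‖z + (j * h) • α‖ < w) :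
    N ≤ J * ((Finset.Ico X (X + N + J * h)).filter (fun n : ℕ => ‖n • α - y‖ < w)).card := by
  choose j hj hjw using fun n : ℕ => hcov (n • α - y)
  have hcard : (Finset.Ico X (X + N)).card ≤ (Finset.range J ×ˢ
      (Finset.Ico X (X + N + J * h)).filter (fun n : ℕ => ‖n • α - y‖ < w)).card := by
    refine Finset.card_le_card_of_injOn (fun n => (j n, n + j n * h)) ?_ ?_
    · intro n hn
      simp only [Finset.mem_coe, Finset.mem_Ico] at hn
      simp only [Finset.coe_product, Set.mem_prod, Finset.mem_coe, Finset.mem_range,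
        Finset.mem_filter, Finset.mem_Ico]
      have : j n * h ≤ J * h := Nat.mul_le_mul_right _ (hj n).le
      refine ⟨hj n, ⟨by omega, by omega⟩, ?_⟩
      have h2 := hjw n
      rwa [show n • α - y + (j n * h) • α = (n + j n * h) • α - y by rw [add_smul]; abel] at h2
    · intro n _ n' _ he
      simp only [Prod.mk.injEq] at he
      rw [he.1] at he
      omega
  simpa using hcard

theorem UnitAddCircle.norm_coe_of_abs_le {x : ℝ} (hx : |x| ≤ 1 / 2) :
    ‖(x : UnitAddCircle)‖ = |x| := by
  rw [AddCircle.norm_coe_eq_abs_iff _ one_ne_zero]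
  simpa using hx

theorem UnitAddCircle.norm_coe_le (x : ℝ) (p : ℤ) : ‖(x : UnitAddCircle)‖ ≤ |x - p| := by
  rw [UnitAddCircle.norm_eq]
  exact round_le x p

theorem UnitAddCircle.coe_sub_intCast (x : ℝ) (p : ℤ) :
    ((x - p : ℝ) : UnitAddCircle) = (x : UnitAddCircle) := by
  have h : ((p : ℝ) : UnitAddCircle) = 0 := AddCircle.coe_eq_zero_iff _ |>.2 ⟨p, by simp⟩
  rw [AddCircle.coe_sub, h, sub_zero]

theorem UnitAddCircle.coe_natCast_mul (n : ℕ) (x : ℝ) :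
    ((n * x : ℝ) : UnitAddCircle) = n • (x : UnitAddCircle) := by
  rw [← AddCircle.coe_nsmul, nsmul_eq_mul]

/-- Some multiple of `α` is at distance about `1 / H` from an integer. -/
theorem exists_multiple_near_inv (α κ : ℝ) (H : ℕ) (hH : 0 < H) (hκ : 0 < κ)
    (hα : ∀ n : ℕ, 1 ≤ n → n ≤ H → κ ≤ ‖n • (α : UnitAddCircle)‖) :
    ∃ (h : ℕ) (p : ℤ), 1 / (H : ℝ) ≤ |h * α - p| ∧ |h * α - p| ≤ 2 / H ∧ (h : ℝ) ≤ 2 / κ := by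
  obtain ⟨k, hk0, hkH, hk⟩ := Real.exists_nat_abs_mul_sub_round_le α hH
  have hκk := hα k hk0 hkH
  rw [← UnitAddCircle.coe_natCast_mul, UnitAddCircle.norm_eq] at hκk
  set θ := |k * α - round (k * α)| with hθ
  have hH' : (0 : ℝ) < H := by exact_mod_cast hH
  have hθ0 : 0 < θ := hκ.trans_le hκk
  have hθH : θ ≤ 1 / H := hk.trans (one_div_le_one_div_of_le hH' (by linarith))
  -- `t θ` is the first multiple of `θ` to reach `1 / H`; since `θ ≤ 1 / H`, it does not pass `2 /
  -- H`.
  set t := ⌈1 / (H : ℝ) / θ⌉₊ with ht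
  have ht1 : 1 / (H : ℝ) / θ ≤ t := Nat.le_ceil _
  have ht2 : (t : ℝ) < 1 / (H : ℝ) / θ + 1 := Nat.ceil_lt_add_one (by positivity)
  have e : |((t * k : ℕ) : ℝ) * α - ((t * round (k * α) : ℤ) : ℝ)| = t * θ := by
    have : ((t * k : ℕ) : ℝ) * α - ((t * round (k * α) : ℤ) : ℝ) =
        t * (k * α - round (k * α)) := by
      push_cast
      ring
    rw [this, abs_mul, Nat.abs_cast]
  have ht3 : (t : ℝ) * θ < 1 / H + θ := by
    calc (t : ℝ) * θ < (1 / (H : ℝ) / θ + 1) * θ := by gcongr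
      _ = 1 / H + θ := by field_simp
  refine ⟨t * k, t * round (k * α), ?_, ?_, ?_⟩
  · rw [e]
    rwa [div_le_iff₀ hθ0] at ht1
  · rw [e]
    have : 2 / (H : ℝ) = 1 / H + 1 / H := by ring
    linarith
  · have h1 : (t : ℝ) * θ ≤ 2 / H := by
      have : 2 / (H : ℝ) = 1 / H + 1 / H := by ring
      linarith
    rw [le_div_iff₀ hκ]
    calc ((t * k : ℕ) : ℝ) * κ ≤ ((t * H : ℕ) : ℝ) * θ := by gcongr
      _ = (t * θ) * H := by push_cast; ring
      _ ≤ 2 / H * H := by gcongr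
      _ = 2 := by field_simp

theorem nsmul_coe_eq_coe_mul_sub (α : ℝ) (h j : ℕ) (p : ℤ) :
    (j * h) • (α : UnitAddCircle) = ((j * (h * α - p) : ℝ) : UnitAddCircle) := by
  rw [UnitAddCircle.coe_natCast_mul, UnitAddCircle.coe_sub_intCast,
    UnitAddCircle.coe_natCast_mul, mul_smul]

/-- Choose `h` with `h α` displaced by between `1 / (4 J)` and `1 / (2 J)`. Its multiples `j < J`
never go past half a turn, so they stay `1 / (4 J)` away from `0` and `mul_card_visits_le` applies.
-/
theorem card_visits_le (α κ : ℝ) (y : UnitAddCircle) (J N : ℕ) (hJ : 0 < J) (hκ : 0 < κ)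
    (hα : ∀ n : ℕ, 1 ≤ n → n ≤ 4 * J → κ ≤ ‖n • (α : UnitAddCircle)‖) :
    (((Finset.Icc 1 N).filter
      (fun n : ℕ => ‖n • (α : UnitAddCircle) - y‖ < 1 / (8 * J))).card : ℝ) ≤ N / J + 2 / κ := by
  obtain ⟨h, p, h1, h2, h3⟩ := exists_multiple_near_inv α κ (4 * J) (by omega) hκ hα
  have hJ' : (0 : ℝ) < J := by exact_mod_cast hJ
  push_cast at h1 h2
  have := mul_card_visits_le (α : UnitAddCircle) y (1 / (8 * J)) N h J (by
    intro j hj1 hj2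
    have hj1' : (1 : ℝ) ≤ j := by exact_mod_cast hj1
    have hj2' : (j : ℝ) ≤ J := by exact_mod_cast hj2.le
    rw [nsmul_coe_eq_coe_mul_sub α h j p, UnitAddCircle.norm_coe_of_abs_le]
    · rw [abs_mul, Nat.abs_cast]
      calc 2 * (1 / (8 * (J : ℝ))) = 1 * (1 / (4 * J)) := by field_simp; norm_num
        _ ≤ _ := by gcongr
    · rw [abs_mul, Nat.abs_cast]
      calc (j : ℝ) * |h * α - p| ≤ J * (2 / (4 * J)) := by gcongr
        _ = 1 / 2 := by field_simp; norm_num)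
  set Z := (Finset.Icc 1 N).filter
      (fun n : ℕ => ‖n • (α : UnitAddCircle) - y‖ < 1 / (8 * J))
  have hZ : (J : ℝ) * Z.card ≤ N + J * h := by exact_mod_cast this
  calc (Z.card : ℝ) = (J * Z.card) / J := by field_simp
    _ ≤ (N + J * h) / J := by gcongr
    _ = N / J + h := by field_simp
    _ ≤ _ := by gcongr

theorem exists_natCast_mul_near (θ z : ℝ) (H : ℕ) (hH : 0 < H) (h1 : 1 / (H : ℝ) ≤ θ) :
    ∃ j < H + 1, ‖((z + j * θ : ℝ) : UnitAddCircle)‖ < θ := by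
  have hH' : (0 : ℝ) < H := by exact_mod_cast hH
  have hθ : 0 < θ := lt_of_lt_of_le (by positivity) h1
  have hm0 : 0 ≤ (⌈z⌉ : ℝ) - z := by linarith [Int.le_ceil z]
  have hm1 : (⌈z⌉ : ℝ) - z < 1 := by linarith [Int.ceil_lt_add_one z]
  have hj1 := Nat.le_ceil (((⌈z⌉ : ℝ) - z) / θ)
  have hj2 := Nat.ceil_lt_add_one (div_nonneg hm0 hθ.le)
  set j := ⌈((⌈z⌉ : ℝ) - z) / θ⌉₊
  have hHθ : 1 ≤ H * θ := by rwa [div_le_iff₀ hH', mul_comm] at h1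
  rw [div_le_iff₀ hθ] at hj1
  have hj3 : (j : ℝ) * θ < (⌈z⌉ : ℝ) - z + θ := by
    calc (j : ℝ) * θ < (((⌈z⌉ : ℝ) - z) / θ + 1) * θ := by gcongr
      _ = _ := by field_simp
  refine ⟨j, ?_, ?_⟩
  · have : (j : ℝ) * θ < (H + 1) * θ := by linarith
    exact_mod_cast lt_of_mul_lt_mul_right this hθ.le
  · refine (UnitAddCircle.norm_coe_le _ ⌈z⌉).trans_lt ?_
    rw [abs_lt]
    constructor <;> linarith

theorem exists_natCast_mul_near' (θ : ℝ) (z : UnitAddCircle) (H : ℕ) (hH : 0 < H)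
    (h1 : 1 / (H : ℝ) ≤ |θ|) : ∃ j < H + 1, ‖z + ((j * θ : ℝ) : UnitAddCircle)‖ < |θ| := by
  obtain ⟨z, rfl⟩ := QuotientAddGroup.mk_surjective z
  rcases abs_cases θ with ⟨h, -⟩ | ⟨h, -⟩
  · rw [h] at h1 ⊢
    simpa using exists_natCast_mul_near θ z H hH h1
  · rw [h] at h1 ⊢
    obtain ⟨j, hj, hlt⟩ := exists_natCast_mul_near (-θ) (-z) H hH h1
    refine ⟨j, hj, ?_⟩
    rw [← norm_neg, ← AddCircle.coe_neg, show -(-z + j * -θ) = z + j * θ by ring,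
      AddCircle.coe_add] at hlt
    exact hlt

/-- Steps of length between `1 / H` and `2 / H` go round the circle within `H` steps and cannot jump
over a ball of radius `w ≥ 2 / H`. The excess of `Y` over `X + N` leaves room for `H + 1` steps of
size `h ≤ 2 / κ`. -/
theorem le_card_visits (α κ w : ℝ) (y : UnitAddCircle) (H X N Y : ℕ) (hH : 0 < H) (hκ : 0 < κ)
    (hα : ∀ n : ℕ, 1 ≤ n → n ≤ H → κ ≤ ‖n • (α : UnitAddCircle)‖) (hw : 2 / (H : ℝ) ≤ w)
    (hY : (X : ℝ) + N + (H + 1) * (2 / κ) ≤ Y) :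
    (N : ℝ) ≤ (H + 1) * ((Finset.Ico X Y).filter
      (fun n : ℕ => ‖n • (α : UnitAddCircle) - y‖ < w)).card := by
  obtain ⟨h, p, h1, h2, h3⟩ := exists_multiple_near_inv α κ H hH hκ hα
  have key := le_mul_card_visits (α : UnitAddCircle) y w X N h (H + 1) (by
    intro z
    obtain ⟨j, hj, hlt⟩ := exists_natCast_mul_near' (h * α - p) z H hH h1
    refine ⟨j, hj, ?_⟩
    rw [nsmul_coe_eq_coe_mul_sub α h j p]
    exact hlt.trans_le (h2.trans hw))
  have hle : X + N + (H + 1) * h ≤ Y := by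
    have : ((X + N + (H + 1) * h : ℕ) : ℝ) ≤ Y := by
      push_cast
      refine le_trans ?_ hY
      gcongr
    exact_mod_cast this
  have hmono : ((Finset.Ico X (X + N + (H + 1) * h)).filter
      (fun n : ℕ => ‖n • (α : UnitAddCircle) - y‖ < w)).card ≤ ((Finset.Ico X Y).filter
      (fun n : ℕ => ‖n • (α : UnitAddCircle) - y‖ < w)).card :=
    Finset.card_le_card (Finset.filter_subset_filter _ (Finset.Ico_subset_Ico_right hle))
  exact_mod_cast key.trans (Nat.mul_le_mul_left _ hmono)

/-- If small positive multiples of `γ` stay away from `0`, then the return times to a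
neighbourhood of `0` are rare. -/
theorem card_returns_le {E : Type*} [SeminormedAddCommGroup E] (γ : E) (ε : ℝ) (S M : ℕ)
    (hS : 0 < S) (hγ : ∀ d : ℕ, 0 < d → d < S → 2 * ε < ‖d • γ‖) :
    ((Finset.Icc 1 M).filter (fun d : ℕ => ‖d • γ‖ ≤ ε)).card ≤ M / S := by
  have key : ∀ d d' : ℕ, d < d' → ‖d • γ‖ ≤ ε → ‖d' • γ‖ ≤ ε → d / S = d' / S → False := by
    intro d d' hlt h1 h2 he
    have h3 := Nat.div_add_mod d S
    have h4 := Nat.div_add_mod d' S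
    have h5 := Nat.mod_lt d hS
    have h6 := Nat.mod_lt d' hS
    rw [he] at h3
    have h7 := hγ (d' - d) (by omega) (by omega)
    have h8 : (d' - d) • γ = d' • γ - d • γ := by
      obtain ⟨e, rfl⟩ := Nat.exists_eq_add_of_lt hlt
      rw [show d + e + 1 - d = e + 1 by omega, show d + e + 1 = d + (e + 1) by omega,
        add_smul d (e + 1) γ, add_sub_cancel_left]
    rw [h8] at h7
    linarith [norm_sub_le (d' • γ) (d • γ)]
  have : ((Finset.Icc 1 M).filter (fun d : ℕ => ‖d • γ‖ ≤ ε)).card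
      ≤ (Finset.Icc 1 (M / S)).card := by
    refine Finset.card_le_card_of_injOn (fun d => d / S) ?_ ?_
    · intro d hd
      simp only [Finset.mem_coe, Finset.mem_filter, Finset.mem_Icc] at hd ⊢
      refine ⟨?_, Nat.div_le_div_right hd.1.2⟩
      by_contra hcon
      have hdS : d < S := by
        by_contra hge
        exact hcon (Nat.div_pos (not_lt.1 hge) hS)
      linarith [hγ d hd.1.1 hdS, norm_nonneg (d • γ)]
    · intro d hd d' hd' he
      simp only [Finset.mem_coe, Finset.mem_filter] at hd hd'
      rcases lt_trichotomy d d' with hlt | h | hlt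
      · exact (key d d' hlt hd.2 hd'.2 he).elim
      · exact h
      · exact (key d' d hlt hd'.2 hd.2 he.symm).elim
  simpa using this

end Counting

/-! ### Measures of the approximation sets and their intersections, and a Borel–Cantelli lemma. -/

section Measure

open MeasureTheory
open scoped Classical ENNReal

theorem UnitAddCircle.measurePreserving_nsmul {n : ℕ} (hn : 0 < n) :
    MeasurePreserving (fun x : UnitAddCircle => n • x) volume volume := by
  rcases Nat.lt_or_ge 1 n with h | h
  · exact (AddCircle.ergodic_nsmul h).toMeasurePreserving
  · obtain rfl : n = 1 := by omega
    simp only [one_smul]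
    exact MeasurePreserving.id (volume : Measure UnitAddCircle)

theorem UnitAddCircle.volume_ball (x : UnitAddCircle) {δ : ℝ} (h1 : δ ≤ 1 / 2) :
    volume (Metric.ball x δ) = ENNReal.ofReal (2 * δ) := by
  apply le_antisymm
  · refine (measure_mono Metric.ball_subset_closedBall).trans ?_
    rw [AddCircle.volume_closedBall]
    exact ENNReal.ofReal_le_ofReal (min_le_right _ _)
  · refine le_of_forall_lt fun b hb => ?_
    have hbt : b ≠ ∞ := hb.ne_top
    rw [← ENNReal.ofReal_toReal hbt, ENNReal.ofReal_lt_ofReal_iff_of_nonneg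
      ENNReal.toReal_nonneg] at hb
    obtain ⟨c, hc1, hc2⟩ := exists_between hb
    have hle : volume (Metric.closedBall x (c / 2)) ≤ volume (Metric.ball x δ) :=
      measure_mono (Metric.closedBall_subset_ball (by linarith))
    rw [AddCircle.volume_closedBall, min_eq_right (by linarith)] at hle
    refine lt_of_lt_of_le ?_ hle
    rw [← ENNReal.ofReal_toReal hbt]
    have hb0 : 0 ≤ b.toReal := ENNReal.toReal_nonneg
    exact (ENNReal.ofReal_lt_ofReal_iff (by linarith)).2 (by linarith)

/-- The set of points `x` of the circle with `‖q x - γ‖ < δ`. -/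
def nearSet (γ : UnitAddCircle) (q : ℕ) (δ : ℝ) : Set UnitAddCircle :=
  {x | ‖q • x - γ‖ < δ}

theorem nearSet_eq_preimage (γ : UnitAddCircle) (q : ℕ) (δ : ℝ) :
    nearSet γ q δ = (fun x => q • x) ⁻¹' Metric.ball γ δ := by
  ext x
  simp [nearSet, dist_eq_norm]

theorem measurableSet_nearSet (γ : UnitAddCircle) (q : ℕ) (δ : ℝ) :
    MeasurableSet (nearSet γ q δ) := by
  rw [nearSet_eq_preimage]
  exact (Metric.isOpen_ball.preimage (continuous_nsmul q)).measurableSet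

theorem volume_nearSet (γ : UnitAddCircle) {q : ℕ} (hq : 0 < q) {δ : ℝ} (h1 : δ ≤ 1 / 2) :
    volume (nearSet γ q δ) = ENNReal.ofReal (2 * δ) := by
  rw [nearSet_eq_preimage, (UnitAddCircle.measurePreserving_nsmul hq).measure_preimage
    Metric.isOpen_ball.nullMeasurableSet, UnitAddCircle.volume_ball γ h1]

theorem Int.card_le_of_abs_add_lt (s : Finset ℤ) (z L : ℝ) (hL : 0 ≤ L)
    (hs : ∀ v ∈ s, |z + v| < L) : (s.card : ℝ) ≤ 2 * L + 1 := by
  have hsub : s ⊆ Finset.Icc ⌈-z - L⌉ ⌊-z + L⌋ := by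
    intro v hv
    have := abs_lt.1 (hs v hv)
    rw [Finset.mem_Icc, Int.ceil_le, Int.le_floor]
    constructor <;> linarith
  have h := Finset.card_le_card hsub
  rw [Int.card_Icc] at h
  have h1 := Int.floor_le (-z + L)
  have h2 := Int.le_ceil (-z - L)
  rcases le_total 0 (⌊-z + L⌋ + 1 - ⌈-z - L⌉) with h3 | h3
  · have h4 : (s.card : ℤ) ≤ ⌊-z + L⌋ + 1 - ⌈-z - L⌉ := by omega
    have h5 : (s.card : ℝ) ≤ ⌊-z + L⌋ + 1 - ⌈-z - L⌉ := by exact_mod_cast h4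
    linarith
  · have h4 : s.card = 0 := by omega
    rw [h4]
    simp only [Nat.cast_zero]
    linarith

/-- As `a` is invertible mod `b`, distinct `i` give distinct integers `a i - b · round(z + a i /
b)`, all lying in an interval of length `2 δ b`. -/
theorem card_rotations_near_le (z : UnitAddCircle) (a b : ℕ) (hb : 0 < b) (hab : a.Coprime b)
    (δ : ℝ) (hδ : 0 ≤ δ) :
    (((Finset.range b).filter (fun i : ℕ =>
      ‖z + a • ((i / b : ℝ) : UnitAddCircle)‖ < δ)).card : ℝ) ≤ 2 * δ * b + 1 := by
  obtain ⟨z, rfl⟩ := QuotientAddGroup.mk_surjective z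
  have hb' : (0 : ℝ) < b := by exact_mod_cast hb
  set I := (Finset.range b).filter (fun i : ℕ =>
      ‖(QuotientAddGroup.mk z : UnitAddCircle) + a • ((i / b : ℝ) : UnitAddCircle)‖ < δ) with hI
  have hmem : ∀ i ∈ I, |z + a * (i / b) - round (z + a * (i / b) : ℝ)| < δ := by
    intro i hi
    have h := (Finset.mem_filter.1 hi).2
    rw [← UnitAddCircle.coe_natCast_mul] at h
    rw [← UnitAddCircle.norm_eq, AddCircle.coe_add]
    exact h
  set v : ℕ → ℤ := fun i => a * i - b * round (z + a * (i / b) : ℝ) with hv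
  have hinj : Set.InjOn v I := by
    intro i hi j hj he
    have hi' := Finset.mem_range.1 (Finset.mem_filter.1 hi).1
    have hj' := Finset.mem_range.1 (Finset.mem_filter.1 hj).1
    have h1 : (a * i : ℤ) ≡ a * j [ZMOD b] := by
      refine (Int.modEq_iff_dvd).2 ⟨round (z + a * (j / b) : ℝ) - round (z + a * (i / b) : ℝ), ?_⟩
      simp only [hv] at he
      linarith
    have h2 : a * i ≡ a * j [MOD b] := by
      rw [← Int.natCast_modEq_iff]
      exact_mod_cast h1
    have h3 : i ≡ j [MOD b] := Nat.ModEq.cancel_left_of_coprime hab.symm h2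
    exact Nat.ModEq.eq_of_lt_of_lt h3 hi' hj'
  rw [← Finset.card_image_of_injOn hinj]
  have := Int.card_le_of_abs_add_lt (I.image v) (b * z) (δ * b) (by positivity) (by
    intro w hw
    obtain ⟨i, hi, rfl⟩ := Finset.mem_image.1 hw
    have h := hmem i hi
    have e : b * z + (v i : ℝ) = b * (z + a * (i / b) - round (z + a * (i / b) : ℝ)) := by
      simp only [hv]
      push_cast
      have : (b : ℝ) * (a * (i / b)) = a * i := by field_simp
      linear_combination -this
    rw [e, abs_mul, Nat.abs_cast, mul_comm]
    exact mul_lt_mul_of_pos_right h hb')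
  linarith

/-- Translation by `i / b` preserves the measure and the set attached to `b`. Averaging over `i`
replaces the set attached to `a` by a count of rotations, bounded pointwise by
`card_rotations_near_le`. -/
theorem volume_nearSet_inter_le_of_coprime (γ : UnitAddCircle) {a b : ℕ} (hb : 0 < b)
    (hab : a.Coprime b) {δ ε : ℝ} (hδ : 0 ≤ δ) (hε : ε ≤ 1 / 2) :
    b * volume (nearSet γ a δ ∩ nearSet γ b ε) ≤
      ENNReal.ofReal (2 * δ * b + 1) * ENNReal.ofReal (2 * ε) := by
  have hb' : (0 : ℝ) < b := by exact_mod_cast hb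
  set S : ℕ → Set UnitAddCircle := fun i =>
    {x | ‖(a • x - γ) + a • ((i / b : ℝ) : UnitAddCircle)‖ < δ} with hS
  have hSm : ∀ i, MeasurableSet (S i) := fun i =>
    (isOpen_lt (by fun_prop) continuous_const).measurableSet
  have hshift : ∀ i ∈ Finset.range b,
      volume (nearSet γ a δ ∩ nearSet γ b ε) = volume (S i ∩ nearSet γ b ε) := by
    intro i _
    rw [← measure_preimage_add_right volume ((i / b : ℝ) : UnitAddCircle)]
    congr 1
    ext x
    have e1 : b • (x + ((i / b : ℝ) : UnitAddCircle)) = b • x := by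
      have h0 : b • ((i / b : ℝ) : UnitAddCircle) = 0 := by
        rw [← UnitAddCircle.coe_natCast_mul, AddCircle.coe_eq_zero_iff]
        exact ⟨i, by simp; field_simp⟩
      rw [smul_add, h0, add_zero]
    have e2 : a • (x + ((i / b : ℝ) : UnitAddCircle)) - γ =
        (a • x - γ) + a • ((i / b : ℝ) : UnitAddCircle) := by
      rw [smul_add]; abel
    simp only [nearSet, hS, Set.preimage_inter, Set.mem_inter_iff, Set.mem_preimage,
      Set.mem_ofPred_eq, e1, e2]
  calc (b : ℝ≥0∞) * volume (nearSet γ a δ ∩ nearSet γ b ε)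
      = ∑ i ∈ Finset.range b, volume (S i ∩ nearSet γ b ε) := by
        rw [← Finset.sum_congr rfl hshift]
        simp
    _ = ∑ i ∈ Finset.range b, ∫⁻ x in nearSet γ b ε, (S i).indicator 1 x := by
        refine Finset.sum_congr rfl fun i _ => ?_
        rw [lintegral_indicator_one (hSm i), Measure.restrict_apply (hSm i)]
    _ = ∫⁻ x in nearSet γ b ε, ∑ i ∈ Finset.range b, (S i).indicator 1 x := by
        rw [lintegral_finsetSum]
        exact fun i _ => measurable_one.indicator (hSm i)
    _ ≤ ∫⁻ _ in nearSet γ b ε, ENNReal.ofReal (2 * δ * b + 1) := by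
        refine lintegral_mono fun x => ?_
        have h := card_rotations_near_le (a • x - γ) a b hb hab δ hδ
        have e : ∑ i ∈ Finset.range b, (S i).indicator (1 : UnitAddCircle → ℝ≥0∞) x =
            (((Finset.range b).filter (fun i : ℕ =>
              ‖(a • x - γ) + a • ((i / b : ℝ) : UnitAddCircle)‖ < δ)).card : ℝ≥0∞) := by
          simp [Set.indicator_apply, hS]
        rw [e, ← ENNReal.ofReal_natCast]
        exact ENNReal.ofReal_le_ofReal h
    _ = _ := by
        rw [lintegral_const, Measure.restrict_apply_univ, volume_nearSet γ hb hε]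

/-- Both sets are preimages under multiplication by the gcd, which preserves measure, so the coprime
case applies to the quotients. -/
theorem volume_nearSet_inter_le (γ : UnitAddCircle) {q r : ℕ} (hr : 0 < r)
    {δ ε : ℝ} (hδ : 0 ≤ δ) (hε0 : 0 ≤ ε) (hε : ε ≤ 1 / 2) :
    volume.real (nearSet γ q δ ∩ nearSet γ r ε) ≤
      (2 * δ) * (2 * ε) + 2 * (q.gcd r * (ε / r)) := by
  set g := q.gcd r with hg
  have hg0 : 0 < g := Nat.gcd_pos_of_pos_right q hr
  obtain ⟨a, ha⟩ : g ∣ q := Nat.gcd_dvd_left q r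
  obtain ⟨b, hb⟩ : g ∣ r := Nat.gcd_dvd_right q r
  have hb0 : 0 < b := Nat.pos_of_ne_zero (by rintro rfl; omega)
  have hab : a.Coprime b := by
    have h := Nat.gcd_mul_left g a b
    rw [← ha, ← hb, ← hg] at h
    exact Nat.eq_of_mul_eq_mul_left hg0 (by rw [mul_one]; exact h.symm)
  have e : nearSet γ q δ ∩ nearSet γ r ε =
      (fun x => g • x) ⁻¹' (nearSet γ a δ ∩ nearSet γ b ε) := by
    ext x
    simp only [nearSet, Set.preimage_inter, Set.mem_inter_iff, Set.mem_preimage,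
      Set.mem_ofPred_eq, ← mul_smul]
    rw [ha, hb, mul_comm g a, mul_comm g b]
  have h := volume_nearSet_inter_le_of_coprime γ hb0 hab hδ hε
  rw [← (UnitAddCircle.measurePreserving_nsmul hg0).measure_preimage
    ((measurableSet_nearSet γ a δ).inter (measurableSet_nearSet γ b ε)).nullMeasurableSet,
    ← e] at h
  have hb' : (0 : ℝ) < b := by exact_mod_cast hb0
  have hg' : (0 : ℝ) < g := by exact_mod_cast hg0
  have h2 := ENNReal.toReal_mono (by finiteness) h
  rw [ENNReal.toReal_mul, ENNReal.toReal_mul, ENNReal.toReal_ofReal (by positivity),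
    ENNReal.toReal_ofReal (by positivity), ENNReal.toReal_natCast] at h2
  rw [measureReal_def]
  calc (volume (nearSet γ q δ ∩ nearSet γ r ε)).toReal
      = (b * (volume (nearSet γ q δ ∩ nearSet γ r ε)).toReal) / b := by field_simp
    _ ≤ ((2 * δ * b + 1) * (2 * ε)) / b := by gcongr
    _ = _ := by
      have : (r : ℝ) = g * b := by exact_mod_cast hb
      rw [this]
      field_simp

/-- Eliminate `x` between the two conditions: `a (g b x - γ) - b (g a x - γ) = (b - a) γ`. -/
theorem norm_sub_nsmul_le_of_mem_nearSet_inter {γ x : UnitAddCircle} {g a b : ℕ} (hlt : a ≤ b)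
    (hb : 0 < b) {δ ε : ℝ} (hx1 : x ∈ nearSet γ (g * a) δ) (hx2 : x ∈ nearSet γ (g * b) ε) :
    ‖(b - a) • γ‖ ≤ b * δ + a * ε := by
  have e : (b - a) • γ = a • ((g * b) • x - γ) - b • ((g * a) • x - γ) := by
    obtain ⟨d, rfl⟩ := Nat.exists_eq_add_of_le hlt
    rw [Nat.add_sub_cancel_left, smul_sub, smul_sub, ← mul_smul, ← mul_smul, add_smul a d γ,
      show a * (g * (a + d)) = (a + d) * (g * a) by ring]
    abel
  rw [e]
  refine (norm_sub_le _ _).trans ?_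
  have h1 := norm_nsmul_le (n := a) (a := (g * b) • x - γ)
  have h2 := norm_nsmul_le (n := b) (a := (g * a) • x - γ)
  have h3 : (a : ℝ) * ‖(g * b) • x - γ‖ ≤ a * ε := by
    gcongr; exact le_of_lt hx2
  have h4 : (b : ℝ) * ‖(g * a) • x - γ‖ ≤ b * δ := by
    gcongr; exact le_of_lt hx1
  linarith

/-- A divergence Borel–Cantelli lemma with a variance bound that is linear in the mean. -/
theorem ae_infinite_of_sum_inter_le {Ω : Type*} [MeasurableSpace Ω] (μ : Measure Ω)
    [IsProbabilityMeasure μ] (A : ℕ → Set Ω) (hA : ∀ q, MeasurableSet (A q)) (F : ℕ → Finset ℕ)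
    (C : ℝ) (hE : Filter.Tendsto (fun T => ∑ q ∈ F T, μ.real (A q)) Filter.atTop Filter.atTop)
    (hvar : ∀ T, ∑ q ∈ F T, ∑ r ∈ F T, μ.real (A q ∩ A r) ≤
      (∑ q ∈ F T, μ.real (A q)) ^ 2 + ∑ q ∈ F T, μ.real (A q) + C) :
    ∀ᵐ x ∂μ, {q | x ∈ A q}.Infinite := by
  set S : ℕ → Ω → ℝ := fun T x => ∑ q ∈ F T, (A q).indicator 1 x with hS
  have hint : ∀ B : Set Ω, MeasurableSet B → Integrable (B.indicator (1 : Ω → ℝ)) μ :=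
    fun B hB => (integrable_const (1 : ℝ)).indicator hB
  have hnull : ∀ M : ℕ, μ {x | ∀ T, S T x ≤ M} = 0 := by
    intro M
    rw [← measureReal_eq_zero_iff]
    by_contra hne
    set m := μ.real {x | ∀ T, S T x ≤ M} with hm
    have hm0 : 0 < m := lt_of_le_of_ne measureReal_nonneg (Ne.symm hne)
    -- `E > 2 M` gives `E - M ≥ E / 2`, so Chebyshev yields `m E² / 4 ≤ E + C ≤ E (1 + |C|)`, which
    -- the last lower bound on `E` forbids.
    obtain ⟨T, hT⟩ := (hE.eventually_gt_atTop
      (max (max 1 (2 * M)) (4 * (1 + |C|) / m))).exists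
    set E := ∑ q ∈ F T, μ.real (A q) with hEdef
    obtain ⟨hT12, hT3⟩ := max_lt_iff.1 hT
    obtain ⟨hT1, hT2⟩ := max_lt_iff.1 hT12
    have hSint : Integrable (S T) μ := integrable_finsetSum _ fun q _ => hint _ (hA q)
    have hSS : ∀ x, S T x ^ 2 = ∑ q ∈ F T, ∑ r ∈ F T, (A q ∩ A r).indicator 1 x := by
      intro x
      simp only [hS, sq, Finset.sum_mul_sum]
      refine Finset.sum_congr rfl fun q _ => Finset.sum_congr rfl fun r _ => ?_
      rw [Set.inter_indicator_one]
      rfl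
    have hSSint : Integrable (fun x => S T x ^ 2) μ := by
      simp only [hSS]
      exact integrable_finsetSum _ fun q _ => integrable_finsetSum _ fun r _ =>
        hint _ ((hA q).inter (hA r))
    have hI1 : ∫ x, S T x ∂μ = E := by
      simp only [hS]
      rw [integral_finsetSum _ fun q _ => hint _ (hA q)]
      exact Finset.sum_congr rfl fun q _ => integral_indicator_one (hA q)
    have hI2 : ∫ x, S T x ^ 2 ∂μ ≤ E ^ 2 + E + C := by
      simp only [hSS]
      rw [integral_finsetSum _ fun q _ => integrable_finsetSum _ fun r _ =>
        hint _ ((hA q).inter (hA r))]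
      refine le_trans (le_of_eq ?_) (hvar T)
      refine Finset.sum_congr rfl fun q _ => ?_
      rw [integral_finsetSum _ fun r _ => hint _ ((hA q).inter (hA r))]
      exact Finset.sum_congr rfl fun r _ => integral_indicator_one ((hA q).inter (hA r))
    have hexp : ∀ x, (S T x - E) ^ 2 = S T x ^ 2 - (2 * E) * S T x + E ^ 2 := fun x => by ring
    have hd : Integrable (fun x => S T x ^ 2 - (2 * E) * S T x) μ :=
      hSSint.sub (hSint.const_mul _)
    have hvint : Integrable (fun x => (S T x - E) ^ 2) μ := by
      simp only [hexp]
      exact hd.add (integrable_const _)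
    have hI3 : ∫ x, (S T x - E) ^ 2 ∂μ ≤ E + C := by
      simp only [hexp]
      rw [integral_add hd (integrable_const _),
        integral_sub hSSint (hSint.const_mul _), integral_const_mul, hI1]
      simp
      linarith
    have hcheb := mul_meas_ge_le_integral_of_nonneg (μ := μ)
      (f := fun x => (S T x - E) ^ 2) (Filter.Eventually.of_forall fun x => sq_nonneg _) hvint
      ((E - M) ^ 2)
    have hsub : m ≤ μ.real {x | (E - M) ^ 2 ≤ (S T x - E) ^ 2} := by
      refine measureReal_mono fun x hx => ?_
      have h1 : S T x ≤ M := hx T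
      have h2 : E - M ≤ E - S T x := by linarith
      have h3 : 0 ≤ E - M := by linarith [(Nat.cast_nonneg M : (0 : ℝ) ≤ M)]
      change (E - M) ^ 2 ≤ (S T x - E) ^ 2
      nlinarith
    have h4 : (E / 2) ^ 2 * m ≤ E + C := by
      refine le_trans ?_ (hcheb.trans hI3)
      have : (E / 2) ^ 2 ≤ (E - M) ^ 2 := by nlinarith
      exact mul_le_mul this hsub hm0.le (sq_nonneg _)
    rw [div_lt_iff₀ hm0] at hT3
    have h5 : E + C ≤ E * (1 + |C|) := by
      have := le_abs_self C
      have := abs_nonneg C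
      nlinarith
    nlinarith
  have hnull' : μ (⋃ M : ℕ, {x | ∀ T, S T x ≤ M}) = 0 := measure_iUnion_null hnull
  rw [ae_iff]
  refine measure_mono_null (fun x hx => ?_) hnull'
  have hfin : {q | x ∈ A q}.Finite := Set.not_infinite.1 hx
  refine Set.mem_iUnion.2 ⟨hfin.toFinset.card, fun T => ?_⟩
  have e : S T x = (((F T).filter (fun q => x ∈ A q)).card : ℝ) := by
    simp [hS, Set.indicator_apply]
  rw [e]
  exact_mod_cast Finset.card_le_card fun q hq => by
    simpa using (Finset.mem_filter.1 hq).2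

end Measure

/-! ### Counting pairs of intersecting approximation sets. -/

section Overlaps

open MeasureTheory
open scoped Classical

/-- `card_visits_le` for the rotation by `g β` with `8 J = 2 ^ u`. The main term accounts for `8` of
the `9`; the size of `K` makes the error `2 / κ` at most one more unit. -/
theorem card_visits_multiple_le (β c : ℝ) (y : UnitAddCircle) (R K A t g u M : ℕ) (hc : 0 < c)
    (hβ : ∀ n : ℕ, 1 ≤ n → c / (n : ℝ) ^ R ≤ ‖n • (β : UnitAddCircle)‖)
    (hg : 0 < g) (hgA : g ≤ 2 ^ (A * t)) (hu3 : 3 ≤ u) (hu : u ≤ 4 * t)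
    (hK : (A + 4) * (R + 1) + 1 ≤ K) (ht : 2 ≤ c * 2 ^ t)
    (hM : (M : ℝ) ≤ 2 ^ (K * (t + 1)) / g) :
    (((Finset.Icc 1 M).filter
      (fun b : ℕ => ‖(g * b) • (β : UnitAddCircle) - y‖ < 1 / 2 ^ u)).card : ℝ) ≤
      9 * (2 ^ (K * (t + 1)) / (2 ^ u * g)) := by
  have hg' : (0 : ℝ) < g := by exact_mod_cast hg
  have hJ8 : (8 : ℝ) * ((2 ^ (u - 3) : ℕ) : ℝ) = 2 ^ u := by
    obtain ⟨v, rfl⟩ := Nat.exists_eq_add_of_le hu3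
    rw [Nat.add_sub_cancel_left]
    push_cast
    ring
  have hJ4 : 4 * 2 ^ (u - 3) ≤ 2 ^ u := by
    obtain ⟨v, rfl⟩ := Nat.exists_eq_add_of_le hu3
    rw [Nat.add_sub_cancel_left, pow_add]
    omega
  have e : ∀ n : ℕ, n • ((g * β : ℝ) : UnitAddCircle) = (g * n) • (β : UnitAddCircle) := by
    intro n
    rw [UnitAddCircle.coe_natCast_mul, ← mul_smul, mul_comm]
  have hκ : 0 < c / ((2 : ℝ) ^ u * g) ^ R := by positivity
  have h := card_visits_le (g * β) (c / ((2 : ℝ) ^ u * g) ^ R) y (2 ^ (u - 3)) M (by positivity) hκ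
    (by
      intro n hn1 hn2
      rw [e]
      refine le_trans ?_ (hβ (g * n) (by nlinarith))
      have : ((g * n : ℕ) : ℝ) ≤ 2 ^ u * g := by
        have : g * n ≤ 2 ^ u * g := by nlinarith
        exact_mod_cast this
      have h0 : (0 : ℝ) < ((g * n : ℕ) : ℝ) := by
        exact_mod_cast Nat.mul_pos hg hn1
      gcongr)
  simp only [e, hJ8] at h
  refine h.trans ?_
  have hb : (2 : ℝ) ^ u * g ≤ 2 ^ ((A + 4) * t) := by
    have h1 : (2 : ℝ) ^ u ≤ 2 ^ (4 * t) := pow_le_pow_right₀ (by norm_num) hu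
    have h2 : (g : ℝ) ≤ 2 ^ (A * t) := by exact_mod_cast hgA
    calc (2 : ℝ) ^ u * g ≤ 2 ^ (4 * t) * 2 ^ (A * t) := by gcongr
      _ = _ := by rw [← pow_add]; congr 1; ring
  have hmain : 2 * ((2 : ℝ) ^ u * g) ^ (R + 1) ≤ c * 2 ^ (K * (t + 1)) := by
    calc 2 * ((2 : ℝ) ^ u * g) ^ (R + 1)
        ≤ (c * 2 ^ t) * (2 ^ ((A + 4) * t)) ^ (R + 1) := by gcongr
      _ = c * 2 ^ (((A + 4) * (R + 1) + 1) * t) := by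
        rw [← pow_mul, mul_assoc, ← pow_add]; congr 2; ring
      _ ≤ _ := by
        gcongr
        · norm_num
        · omega
  have h1 : (M : ℝ) / ((2 ^ (u - 3) : ℕ) : ℝ) ≤ 8 * (2 ^ (K * (t + 1)) / (2 ^ u * g)) := by
    rw [← hJ8]
    have hJ0 : (0 : ℝ) < ((2 ^ (u - 3) : ℕ) : ℝ) := by positivity
    calc (M : ℝ) / ((2 ^ (u - 3) : ℕ) : ℝ) ≤ (2 ^ (K * (t + 1)) / g) / ((2 ^ (u - 3) : ℕ) : ℝ) := by
          gcongr
      _ = _ := by field_simp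
  have h2 : 2 / (c / ((2 : ℝ) ^ u * g) ^ R) ≤ 2 ^ (K * (t + 1)) / (2 ^ u * g) := by
    rw [div_div_eq_mul_div, div_le_div_iff₀ hc (by positivity)]
    calc 2 * ((2 : ℝ) ^ u * g) ^ R * (2 ^ u * g) = 2 * ((2 : ℝ) ^ u * g) ^ (R + 1) := by ring
      _ ≤ _ := by rw [mul_comm (2 ^ (K * (t + 1)) : ℝ)]; exact hmain
  linarith

/-- The radii `δ` are supported on integers `q` for which `‖q β - γ'‖` is small. -/
structure AdmissibleRadii (β γ' : ℝ) (K t₀ : ℕ) (δ : ℕ → ℝ) : Prop where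
  nonneg : ∀ q, 0 ≤ δ q
  zero : δ 0 = 0
  block : ∀ q s, 2 ^ (K * s) ≤ q → q < 2 ^ (K * (s + 1)) → 0 < δ q →
    t₀ ≤ s ∧ ‖q • (β : UnitAddCircle) - (γ' : UnitAddCircle)‖ < 1 / 2 ^ (4 * s) ∧
      δ q ≤ 2 ^ (5 * s) / 2 ^ (K * s)

/-- The two approximation sets attached to `q` and `r` have nonempty intersection. -/
def Overlapping (γ : ℝ) (δ : ℕ → ℝ) (q r : ℕ) : Prop :=
  (nearSet γ q (δ q) ∩ nearSet γ r (δ r)).Nonempty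

theorem Overlapping.left_pos {γ : ℝ} {δ : ℕ → ℝ} {q r : ℕ} (h : Overlapping γ δ q r) :
    0 < δ q := by
  obtain ⟨x, hx, -⟩ := h
  exact (norm_nonneg _).trans_lt hx

theorem Overlapping.right_pos {γ : ℝ} {δ : ℕ → ℝ} {q r : ℕ} (h : Overlapping γ δ q r) :
    0 < δ r := by
  obtain ⟨x, -, hx⟩ := h
  exact (norm_nonneg _).trans_lt hx

theorem exists_block {K : ℕ} (hK : 0 < K) {q : ℕ} (hq : 0 < q) :
    ∃ s, 2 ^ (K * s) ≤ q ∧ q < 2 ^ (K * (s + 1)) := by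
  refine ⟨Nat.log (2 ^ K) q, ?_, ?_⟩
  · rw [pow_mul]
    exact Nat.pow_log_le_self _ hq.ne'
  · rw [pow_mul]
    exact Nat.lt_pow_succ_log_self (Nat.one_lt_two_pow hK.ne') q

/-- Data on the smaller member of an overlapping pair that is not too small. -/
theorem AdmissibleRadii.of_large {β γ' : ℝ} {K t₀ : ℕ} {δ : ℕ → ℝ}
    (hδ : AdmissibleRadii β γ' K t₀ δ) (hK : 12 ≤ K) {q t : ℕ} (hpos : 0 < δ q)
    (hq : 2 ^ (K * t) < q * 2 ^ (6 * t)) (hqt : q < 2 ^ (K * (t + 1))) :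
    ‖q • (β : UnitAddCircle) - (γ' : UnitAddCircle)‖ < 1 / 2 ^ (2 * t - 2) ∧
      δ q ≤ 2 ^ (11 * t) * 2 ^ K / 2 ^ (K * t) := by
  have hq0 : 0 < q := Nat.pos_of_ne_zero (by rintro rfl; simp at hq)
  obtain ⟨s, hs1, hs2⟩ := exists_block (by omega : 0 < K) hq0
  obtain ⟨-, h1, h2⟩ := hδ.block q s hs1 hs2 hpos
  have hst : s ≤ t := by
    have : 2 ^ (K * s) < 2 ^ (K * (t + 1)) := hs1.trans_lt hqt
    have := (Nat.pow_lt_pow_iff_right (by norm_num : 1 < 2)).1 this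
    have := Nat.lt_of_mul_lt_mul_left this
    omega
  have hts' : K * t < K * (s + 1) + 6 * t := by
    rw [← Nat.pow_lt_pow_iff_right (by norm_num : 1 < 2), pow_add]
    exact hq.trans (Nat.mul_lt_mul_of_pos_right hs2 (by positivity))
  -- With `K ≥ 12`, a loss of `2 ^ (6 t)` is at most half of the exponent `K t`, so the block index
  -- at most about halves.
  have hts : t < 2 * (s + 1) := by
    by_contra hcon
    have : K * (2 * (s + 1)) ≤ K * t := Nat.mul_le_mul_left _ (not_lt.1 hcon)
    have : 12 * t ≤ K * t := Nat.mul_le_mul_right _ hK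
    nlinarith
  constructor
  · refine h1.trans_le ?_
    apply one_div_le_one_div_of_le (by positivity)
    exact pow_le_pow_right₀ (by norm_num) (by omega)
  · refine h2.trans ?_
    rw [div_le_div_iff₀ (by positivity) (by positivity), ← pow_add, ← pow_add, ← pow_add]
    refine pow_le_pow_right₀ (by norm_num) ?_
    have : K * (s + 1) = K * s + K := by ring
    omega

/-- The saving `2 ^ (6 t)` has three sources: very small `q = g p.1` are few; for moderate `g` both
members are constrained through `β`; for large `g` the difference is constrained through `γ`. -/
theorem card_overlapping_le (β γ γ' c : ℝ) (R K t₀ t g : ℕ) (δ : ℕ → ℝ) (hc : 0 < c)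
    (hR : 1 ≤ R)
    (hβ : ∀ n : ℕ, 1 ≤ n → c / (n : ℝ) ^ R ≤ ‖n • (β : UnitAddCircle)‖)
    (hγ : ∀ n : ℕ, 1 ≤ n → c / (n : ℝ) ^ R ≤ ‖n • (γ : UnitAddCircle)‖)
    (hδ : AdmissibleRadii β γ' K t₀ δ)
    (hK : (15 + 7 * R) * (R + 1) + 1 ≤ K) (ht3 : 3 ≤ t)
    (ht : 2 ^ (2 * K + 3 * R + 7) < c * 2 ^ t) (hg : 0 < g) :
    (((Finset.Icc 1 (2 ^ (K * (t + 1)) / g) ×ˢ Finset.Icc 1 (2 ^ (K * (t + 1)) / g)).filter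
      (fun p : ℕ × ℕ => p.1 < p.2 ∧ g * p.2 ∈ Finset.Ico (2 ^ (K * t)) (2 ^ (K * (t + 1))) ∧
        Overlapping γ δ (g * p.1) (g * p.2))).card : ℝ) ≤
      325 * (2 ^ K) ^ 2 * (2 ^ (K * t)) ^ 2 / (2 ^ (6 * t) * (g : ℝ) ^ 2) := by
  have hg' : (0 : ℝ) < g := by exact_mod_cast hg
  have hK12 : 12 ≤ K := by nlinarith
  have hB1 : (1 : ℝ) ≤ 2 ^ K := one_le_pow₀ (by norm_num)
  have hBt : (2 : ℝ) ^ (K * (t + 1)) = 2 ^ K * 2 ^ (K * t) := by rw [← pow_add]; ring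
  set M := 2 ^ (K * (t + 1)) / g with hM
  have hMr : (M : ℝ) ≤ 2 ^ (K * (t + 1)) / g := by
    have := Nat.cast_div_le (α := ℝ) (m := 2 ^ (K * (t + 1))) (n := g)
    simpa using this
  set M₁ := 2 ^ (K * t) / (2 ^ (6 * t) * g) with hM₁
  have hM₁r : (M₁ : ℝ) ≤ 2 ^ (K * t) / (2 ^ (6 * t) * g) := by
    have := Nat.cast_div_le (α := ℝ) (m := 2 ^ (K * t)) (n := 2 ^ (6 * t) * g)
    simpa using this
  set P := (Finset.Icc 1 M ×ˢ Finset.Icc 1 M).filter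
      (fun p : ℕ × ℕ => p.1 < p.2 ∧ g * p.2 ∈ Finset.Ico (2 ^ (K * t)) (2 ^ (K * (t + 1))) ∧
        Overlapping γ δ (g * p.1) (g * p.2)) with hP
  set P' := P.filter (fun p => 2 ^ (K * t) < g * p.1 * 2 ^ (6 * t)) with hP'
  have hsplit : P ⊆ (Finset.Icc 1 M₁ ×ˢ Finset.Icc 1 M) ∪ P' := by
    intro p hp
    by_cases h : 2 ^ (K * t) < g * p.1 * 2 ^ (6 * t)
    · exact Finset.mem_union_right _ (Finset.mem_filter.2 ⟨hp, h⟩)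
    · refine Finset.mem_union_left _ ?_
      have hp1 := Finset.mem_product.1 (Finset.mem_filter.1 hp).1
      refine Finset.mem_product.2 ⟨Finset.mem_Icc.2 ⟨(Finset.mem_Icc.1 hp1.1).1, ?_⟩, hp1.2⟩
      rw [hM₁, Nat.le_div_iff_mul_le (by positivity)]
      calc p.1 * (2 ^ (6 * t) * g) = g * p.1 * 2 ^ (6 * t) := by ring
        _ ≤ _ := not_lt.1 h
  have hcard1 : (P.card : ℝ) ≤ M₁ * M + P'.card := by
    have h := (Finset.card_le_card hsplit).trans (Finset.card_union_le _ _)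
    rw [Finset.card_product, Nat.card_Icc, Nat.card_Icc] at h
    exact_mod_cast h
  have hfirst : (M₁ : ℝ) * M ≤ (2 ^ K) ^ 2 * (2 ^ (K * t)) ^ 2 / (2 ^ (6 * t) * (g : ℝ) ^ 2) := by
    calc (M₁ : ℝ) * M ≤ (2 ^ (K * t) / (2 ^ (6 * t) * g)) * (2 ^ (K * (t + 1)) / g) := by gcongr
      _ = 1 * 2 ^ K * (2 ^ (K * t)) ^ 2 / (2 ^ (6 * t) * (g : ℝ) ^ 2) := by
        rw [hBt]; field_simp
      _ ≤ (2 ^ K * 2 ^ K) * (2 ^ (K * t)) ^ 2 / (2 ^ (6 * t) * (g : ℝ) ^ 2) := by gcongr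
      _ = _ := by ring
  have hdata : ∀ p ∈ P', (p.1 ∈ Finset.Icc 1 M ∧ p.2 ∈ Finset.Icc 1 M) ∧ p.1 < p.2 ∧
      (g * p.2 < 2 ^ (K * (t + 1)) ∧ Overlapping γ δ (g * p.1) (g * p.2)) ∧
      (‖(g * p.1) • (β : UnitAddCircle) - (γ' : UnitAddCircle)‖ < 1 / 2 ^ (2 * t - 2) ∧
      δ (g * p.1) ≤ 2 ^ (11 * t) * 2 ^ K / 2 ^ (K * t)) ∧
      ‖(g * p.2) • (β : UnitAddCircle) - (γ' : UnitAddCircle)‖ < 1 / 2 ^ (4 * t) ∧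
      δ (g * p.2) ≤ 2 ^ (5 * t) / 2 ^ (K * t) := by
    intro p hp
    obtain ⟨hp1, hp2⟩ := Finset.mem_filter.1 hp
    obtain ⟨hp3, hlt, hI, hov⟩ := Finset.mem_filter.1 hp1
    rw [Finset.mem_Ico] at hI
    have hlt' : g * p.1 < g * p.2 := Nat.mul_lt_mul_of_pos_left hlt hg
    exact ⟨Finset.mem_product.1 hp3, hlt, ⟨hI.2, hov⟩,
      hδ.of_large hK12 hov.left_pos hp2 (hlt'.trans hI.2),
      (hδ.block _ t hI.1 hI.2 hov.right_pos).2⟩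
  have hsecond : (P'.card : ℝ) ≤
      324 * (2 ^ K) ^ 2 * (2 ^ (K * t)) ^ 2 / (2 ^ (6 * t) * (g : ℝ) ^ 2) := by
    -- Below this threshold, visits at scales `2 ^ (-(2 t - 2))` and `2 ^ (-4 t)` together save `2 ^
    -- (6 t) / 4`, whence `324 = 9 · 9 · 4`.
    rcases le_or_gt g (2 ^ ((11 + 7 * R) * t)) with hgA | hgA
    · have h2 : 2 ≤ c * 2 ^ t := by
        refine le_trans ?_ ht.le
        exact_mod_cast Nat.pow_le_pow_right (by norm_num : 0 < 2)
          (by omega : 1 ≤ 2 * K + 3 * R + 7)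
      have hK' : (11 + 7 * R + 4) * (R + 1) + 1 ≤ K := by
        calc _ = (15 + 7 * R) * (R + 1) + 1 := by ring
          _ ≤ K := hK
      have hX₁ := card_visits_multiple_le β c γ' R K (11 + 7 * R) t g (2 * t - 2) M hc hβ hg hgA
        (by omega) (by omega) hK' h2 hMr
      have hX₂ := card_visits_multiple_le β c γ' R K (11 + 7 * R) t g (4 * t) M hc hβ hg hgA
        (by omega) (by omega) hK' h2 hMr
      set X₁ := (Finset.Icc 1 M).filter
        (fun b : ℕ => ‖(g * b) • (β : UnitAddCircle) - γ'‖ < 1 / 2 ^ (2 * t - 2))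
      set X₂ := (Finset.Icc 1 M).filter
        (fun b : ℕ => ‖(g * b) • (β : UnitAddCircle) - γ'‖ < 1 / 2 ^ (4 * t))
      have hsub : P' ⊆ X₁ ×ˢ X₂ := by
        intro p hp
        obtain ⟨hp1, -, -, hp2, hp3⟩ := hdata p hp
        exact Finset.mem_product.2 ⟨Finset.mem_filter.2 ⟨hp1.1, hp2.1⟩,
          Finset.mem_filter.2 ⟨hp1.2, hp3.1⟩⟩
      have hcard : (P'.card : ℝ) ≤ X₁.card * X₂.card := by
        have h := Finset.card_le_card hsub
        rw [Finset.card_product] at h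
        exact_mod_cast h
      have e1 : (2 : ℝ) ^ (2 * t) = 2 ^ (2 * t - 2) * 4 := by
        obtain ⟨v, hv⟩ := Nat.exists_eq_add_of_le (by omega : 2 ≤ 2 * t)
        rw [hv, Nat.add_sub_cancel_left]; ring
      have e2 : (2 : ℝ) ^ (6 * t) = 2 ^ (2 * t) * 2 ^ (4 * t) := by rw [← pow_add]; congr 1; ring
      calc (P'.card : ℝ) ≤ X₁.card * X₂.card := hcard
        _ ≤ (9 * (2 ^ (K * (t + 1)) / (2 ^ (2 * t - 2) * g))) *
            (9 * (2 ^ (K * (t + 1)) / (2 ^ (4 * t) * g))) := by gcongr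
        _ = _ := by
          rw [e2, e1, hBt]; field_simp; norm_num
    -- For large `g`, an overlap forces `‖(p.2 - p.1) γ‖ ≤ ε`: the `11 t` in the threshold cancels
    -- the size of the radii. The remaining `7 R t` beats the lower bound `c / 2 ^ (6 R t)` for
    -- multiples below `2 ^ (6 t)`.
    · set ε : ℝ := 2 * (2 ^ K) ^ 2 / 2 ^ (7 * R * t) with hε
      have hret := card_returns_le (γ : UnitAddCircle) ε (2 ^ (6 * t)) M (by positivity) (by
        intro d hd0 hd
        refine lt_of_lt_of_le ?_ (hγ d hd0)
        have hd' : (d : ℝ) ≤ 2 ^ (6 * t) := by exact_mod_cast hd.le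
        have hd0' : (0 : ℝ) < d := by exact_mod_cast hd0
        rw [hε, lt_div_iff₀ (by positivity)]
        calc 2 * (2 * (2 ^ K) ^ 2 / 2 ^ (7 * R * t)) * (d : ℝ) ^ R
            ≤ 2 * (2 * (2 ^ K) ^ 2 / 2 ^ (7 * R * t)) * (2 ^ (6 * t)) ^ R := by gcongr
          _ = 2 ^ (2 * K + 2) / 2 ^ (R * t) := by
            have e : (2 : ℝ) ^ (7 * R * t) = (2 ^ (6 * t)) ^ R * 2 ^ (R * t) := by
              rw [← pow_mul, ← pow_add]; congr 1; ring
            rw [e]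
            field_simp
            ring
          _ ≤ 2 ^ (2 * K + 3 * R + 7) / 2 ^ t := by
            have h1 : (2 : ℝ) ^ (2 * K + 2) ≤ 2 ^ (2 * K + 3 * R + 7) :=
              pow_le_pow_right₀ (by norm_num) (by omega)
            have h2 : (2 : ℝ) ^ t ≤ 2 ^ (R * t) :=
              pow_le_pow_right₀ (by norm_num) (Nat.le_mul_of_pos_left t hR)
            gcongr
          _ < c := by rwa [div_lt_iff₀ (by positivity)])
      set Y := (Finset.Icc 1 M).filter (fun d : ℕ => ‖d • (γ : UnitAddCircle)‖ ≤ ε)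
      have hmaps : ∀ p ∈ P', (p.1, p.2 - p.1) ∈ Finset.Icc 1 M ×ˢ Y := by
        intro p hp
        obtain ⟨⟨hp1, hp1'⟩, hlt, ⟨hrB, x, hx1, hx2⟩, hp2, hp3⟩ := hdata p hp
        rw [Finset.mem_Icc] at hp1'
        refine Finset.mem_product.2 ⟨hp1, Finset.mem_filter.2
          ⟨Finset.mem_Icc.2 ⟨by simp only; omega, by simp only; omega⟩, ?_⟩⟩
        refine (norm_sub_nsmul_le_of_mem_nearSet_inter hlt.le (by omega) hx1 hx2).trans ?_
        have hgA' : (2 : ℝ) ^ ((11 + 7 * R) * t) ≤ g := by exact_mod_cast hgA.le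
        have hrB' : (g : ℝ) * p.2 ≤ 2 ^ K * 2 ^ (K * t) := by
          rw [← hBt]; exact_mod_cast hrB.le
        have hqB' : (g : ℝ) * p.1 ≤ 2 ^ K * 2 ^ (K * t) := by
          refine le_trans ?_ hrB'
          have : (p.1 : ℝ) ≤ p.2 := by exact_mod_cast hlt.le
          gcongr
        have h11 : (2 : ℝ) ^ (5 * t) ≤ 2 ^ (11 * t) :=
          pow_le_pow_right₀ (by norm_num) (by omega)
        have key : g * ((p.2 : ℝ) * δ (g * p.1) + p.1 * δ (g * p.2)) ≤
            2 * (2 ^ K) ^ 2 * 2 ^ (11 * t) := by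
          have k1 : (g * p.2 : ℝ) * δ (g * p.1) ≤ (2 ^ K) ^ 2 * 2 ^ (11 * t) := by
            calc (g * p.2 : ℝ) * δ (g * p.1)
                ≤ (2 ^ K * 2 ^ (K * t)) * (2 ^ (11 * t) * 2 ^ K / 2 ^ (K * t)) := by
                  gcongr
                  · exact hδ.nonneg _
                  · exact hp2.2
              _ = _ := by field_simp
          have k2 : (g * p.1 : ℝ) * δ (g * p.2) ≤ (2 ^ K) ^ 2 * 2 ^ (11 * t) := by
            calc (g * p.1 : ℝ) * δ (g * p.2)
                ≤ (2 ^ K * 2 ^ (K * t)) * (2 ^ (5 * t) / 2 ^ (K * t)) := by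
                  gcongr
                  · exact hδ.nonneg _
                  · exact hp3.2
              _ = 2 ^ K * 1 * 2 ^ (5 * t) := by field_simp
              _ ≤ 2 ^ K * 2 ^ K * 2 ^ (11 * t) := by gcongr
              _ = _ := by ring
          nlinarith
        rw [hε, le_div_iff₀ (by positivity)]
        have e : (2 : ℝ) ^ ((11 + 7 * R) * t) = 2 ^ (11 * t) * 2 ^ (7 * R * t) := by
          rw [← pow_add]; congr 1; ring
        have hD0 : 0 ≤ (p.2 : ℝ) * δ (g * p.1) + p.1 * δ (g * p.2) := by
          have := hδ.nonneg (g * p.1)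
          have := hδ.nonneg (g * p.2)
          positivity
        have h11' : (0 : ℝ) < 2 ^ (11 * t) := by positivity
        refine le_of_mul_le_mul_left ?_ h11'
        calc (2 : ℝ) ^ (11 * t) * (((p.2 : ℝ) * δ (g * p.1) + p.1 * δ (g * p.2)) *
              2 ^ (7 * R * t))
            = 2 ^ ((11 + 7 * R) * t) * ((p.2 : ℝ) * δ (g * p.1) + p.1 * δ (g * p.2)) := by
              rw [e]; ring
          _ ≤ g * ((p.2 : ℝ) * δ (g * p.1) + p.1 * δ (g * p.2)) := by gcongr
          _ ≤ _ := by linarith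
      have hcard : P'.card ≤ M * (M / 2 ^ (6 * t)) := by
        have h := Finset.card_le_card_of_injOn (s := P') (t := Finset.Icc 1 M ×ˢ Y)
          (fun p => (p.1, p.2 - p.1)) hmaps (by
            intro p hp p' hp' he
            have h1 := (hdata p hp).2.1
            have h2 := (hdata p' hp').2.1
            simp only [Prod.mk.injEq] at he
            ext
            · exact he.1
            · omega)
        rw [Finset.card_product, Nat.card_Icc, Nat.add_sub_cancel] at h
        exact h.trans (Nat.mul_le_mul_left _ hret)
      have hM6 : ((M / 2 ^ (6 * t) : ℕ) : ℝ) ≤ M / 2 ^ (6 * t) := by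
        have := Nat.cast_div_le (α := ℝ) (m := M) (n := 2 ^ (6 * t))
        simpa using this
      calc (P'.card : ℝ) ≤ M * ((M / 2 ^ (6 * t) : ℕ) : ℝ) := by exact_mod_cast hcard
        _ ≤ M * (M / 2 ^ (6 * t)) := by gcongr
        _ ≤ (2 ^ (K * (t + 1)) / g) * ((2 ^ (K * (t + 1)) / g) / 2 ^ (6 * t)) := by gcongr
        _ = 1 * (2 ^ K) ^ 2 * (2 ^ (K * t)) ^ 2 / (2 ^ (6 * t) * (g : ℝ) ^ 2) := by
          rw [hBt]; field_simp
        _ ≤ _ := by gcongr; norm_num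
  have : 325 * ((2 : ℝ) ^ K) ^ 2 * (2 ^ (K * t)) ^ 2 / (2 ^ (6 * t) * (g : ℝ) ^ 2) =
      (2 ^ K) ^ 2 * (2 ^ (K * t)) ^ 2 / (2 ^ (6 * t) * (g : ℝ) ^ 2) +
      324 * (2 ^ K) ^ 2 * (2 ^ (K * t)) ^ 2 / (2 ^ (6 * t) * (g : ℝ) ^ 2) := by ring
  linarith

end Overlaps

/-! ### Summing the overlap errors. -/

section Variance

open MeasureTheory
open scoped Classical

theorem sum_Icc_one_div_le (n : ℕ) : ∑ g ∈ Finset.Icc (1 : ℕ) (2 ^ n), 1 / (g : ℝ) ≤ 1 + n := by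
  have h := harmonic_le_one_add_log (2 ^ n)
  rw [harmonic_eq_sum_Icc] at h
  push_cast at h
  rw [Real.log_pow] at h
  have h2 : Real.log 2 ≤ 1 := by linarith [Real.log_two_lt_d9]
  calc ∑ g ∈ Finset.Icc (1 : ℕ) (2 ^ n), 1 / (g : ℝ) = ∑ g ∈ Finset.Icc (1 : ℕ) (2 ^ n), (g : ℝ)⁻¹ := by
        simp
    _ ≤ 1 + n * Real.log 2 := h
    _ ≤ 1 + n * 1 := by gcongr
    _ = _ := by ring

/-- The excess of the measure of an intersection over the product of the measures. -/
noncomputable def overlapError (γ : ℝ) (δ : ℕ → ℝ) (q r : ℕ) : ℝ :=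
  if Overlapping γ δ q r then 2 * (q.gcd r * (δ r / r)) else 0

/-- Sort pairs by their gcd `g`. The pair count carries `1 / (2 ^ (6 t) g²)` and each error is at
most `2 g · 2 ^ (5 t) / 2 ^ (2 K t)`, leaving `2 ^ (-t) / g`. The harmonic sum costs only a factor
linear in `t`. -/
theorem sum_overlapError_block_le (β γ γ' c : ℝ) (R K t₀ t : ℕ) (δ : ℕ → ℝ) (hc : 0 < c)
    (hR : 1 ≤ R)
    (hβ : ∀ n : ℕ, 1 ≤ n → c / (n : ℝ) ^ R ≤ ‖n • (β : UnitAddCircle)‖)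
    (hγ : ∀ n : ℕ, 1 ≤ n → c / (n : ℝ) ^ R ≤ ‖n • (γ : UnitAddCircle)‖)
    (hδ : AdmissibleRadii β γ' K t₀ δ)
    (hK : (15 + 7 * R) * (R + 1) + 1 ≤ K) (ht3 : 3 ≤ t)
    (ht : 2 ^ (2 * K + 3 * R + 7) < c * 2 ^ t) :
    ∑ r ∈ Finset.Ico (2 ^ (K * t)) (2 ^ (K * (t + 1))), ∑ q ∈ Finset.range r,
      overlapError γ δ q r ≤ 650 * (2 ^ K) ^ 2 * ((K * (t + 1) + 1) / 2 ^ t) := by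
  set N := 2 ^ (K * (t + 1)) with hN
  set I := Finset.Ico (2 ^ (K * t)) N with hI
  set W := (Finset.range N ×ˢ I).filter
    (fun p : ℕ × ℕ => p.1 < p.2 ∧ Overlapping γ δ p.1 p.2) with hW
  set w : ℝ := 2 * (2 ^ (5 * t) / (2 ^ (K * t)) ^ 2) with hw
  have hw0 : 0 ≤ w := by positivity
  have step1 : ∑ r ∈ I, ∑ q ∈ Finset.range r, overlapError γ δ q r =
      ∑ p ∈ W, overlapError γ δ p.1 p.2 := by
    have e : ∀ r ∈ I, ∑ q ∈ Finset.range r, overlapError γ δ q r =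
        ∑ q ∈ Finset.range N,
          if q < r ∧ Overlapping γ δ q r then overlapError γ δ q r else 0 := by
      intro r hr
      have hr' := (Finset.mem_Ico.1 hr).2
      rw [← Finset.sum_filter]
      symm
      refine Finset.sum_subset_zero_on_sdiff ?_ ?_ fun _ _ => rfl
      · intro q hq
        simp only [Finset.mem_filter, Finset.mem_range] at hq ⊢
        exact hq.2.1
      · intro q hq
        simp only [Finset.mem_sdiff, Finset.mem_filter, Finset.mem_range, not_and] at hq
        unfold overlapError
        rw [if_neg (hq.2 (by omega) hq.1)]
    rw [Finset.sum_congr rfl e, Finset.sum_comm, ← Finset.sum_product', hW, Finset.sum_filter]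
  have hWdata : ∀ p ∈ W, 0 < p.1 ∧ p.1 < p.2 ∧ (2 ^ (K * t) ≤ p.2 ∧ p.2 < N) ∧
      Overlapping γ δ p.1 p.2 := by
    intro p hp
    obtain ⟨h1, h2, h3⟩ := Finset.mem_filter.1 hp
    refine ⟨Nat.pos_of_ne_zero fun h0 => ?_, h2,
      Finset.mem_Ico.1 (Finset.mem_product.1 h1).2, h3⟩
    have := h3.left_pos
    rw [h0, hδ.zero] at this
    exact lt_irrefl _ this
  have step2 : ∀ p ∈ W, overlapError γ δ p.1 p.2 ≤ (p.1.gcd p.2 : ℝ) * w := by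
    intro p hp
    obtain ⟨-, -, h3, h4⟩ := hWdata p hp
    have h5 := (hδ.block _ t h3.1 h3.2 h4.right_pos).2.2
    have h6 : (2 : ℝ) ^ (K * t) ≤ p.2 := by exact_mod_cast h3.1
    unfold overlapError
    rw [if_pos h4]
    calc 2 * ((p.1.gcd p.2 : ℝ) * (δ p.2 / p.2))
        ≤ 2 * ((p.1.gcd p.2 : ℝ) * ((2 ^ (5 * t) / 2 ^ (K * t)) / 2 ^ (K * t))) := by gcongr
      _ = _ := by rw [hw]; field_simp
  have hgcd : ∀ p ∈ W, p.1.gcd p.2 ∈ Finset.Icc 1 N := by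
    intro p hp
    obtain ⟨h1, h2, h3, -⟩ := hWdata p hp
    exact Finset.mem_Icc.2 ⟨Nat.gcd_pos_of_pos_left _ h1,
      (Nat.gcd_le_left _ h1).trans (h2.trans h3.2).le⟩
  have hcard : ∀ g ∈ Finset.Icc 1 N, ((W.filter (fun p => p.1.gcd p.2 = g)).card : ℝ) ≤
      325 * (2 ^ K) ^ 2 * (2 ^ (K * t)) ^ 2 / (2 ^ (6 * t) * (g : ℝ) ^ 2) := by
    intro g hg
    have hg0 : 0 < g := (Finset.mem_Icc.1 hg).1
    refine le_trans ?_ (card_overlapping_le β γ γ' c R K t₀ t g δ hc hR hβ hγ hδ hK ht3 ht hg0)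
    have hmul : ∀ p ∈ W.filter (fun p => p.1.gcd p.2 = g),
        g * (p.1 / g) = p.1 ∧ g * (p.2 / g) = p.2 := by
      intro p hp
      have h := (Finset.mem_filter.1 hp).2
      exact ⟨Nat.mul_div_cancel' (h ▸ Nat.gcd_dvd_left _ _),
        Nat.mul_div_cancel' (h ▸ Nat.gcd_dvd_right _ _)⟩
    norm_cast
    refine Finset.card_le_card_of_injOn (fun p => (p.1 / g, p.2 / g)) ?_ ?_
    · intro p hp
      obtain ⟨e1, e2⟩ := hmul p hp
      obtain ⟨h1, h2, h3, h4⟩ := hWdata p (Finset.mem_filter.1 hp).1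
      have hlt : p.1 / g < p.2 / g := by
        refine lt_of_mul_lt_mul_left ?_ (Nat.zero_le g)
        rw [e1, e2]
        exact h2
      have hpos : 0 < p.1 / g := by
        refine Nat.pos_of_ne_zero fun h0 => ?_
        rw [h0] at e1
        omega
      simp only [Finset.coe_filter, Finset.mem_product, Finset.mem_Icc, Set.mem_ofPred_eq,
        Finset.mem_Ico, e1, e2]
      exact ⟨⟨⟨hpos, Nat.div_le_div_right (h2.trans h3.2).le⟩,
        ⟨by omega, Nat.div_le_div_right h3.2.le⟩⟩, hlt, h3, h4⟩
    · intro p hp p' hp' he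
      simp only [Prod.mk.injEq] at he
      obtain ⟨e1, e2⟩ := hmul p hp
      obtain ⟨e1', e2'⟩ := hmul p' hp'
      ext
      · rw [← e1, ← e1', he.1]
      · rw [← e2, ← e2', he.2]
  rw [step1]
  calc ∑ p ∈ W, overlapError γ δ p.1 p.2 ≤ ∑ p ∈ W, (p.1.gcd p.2 : ℝ) * w :=
        Finset.sum_le_sum step2
    _ = ∑ g ∈ Finset.Icc 1 N, ∑ p ∈ W.filter (fun p => p.1.gcd p.2 = g),
          (p.1.gcd p.2 : ℝ) * w := (Finset.sum_fiberwise_of_maps_to hgcd _).symm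
    _ = ∑ g ∈ Finset.Icc 1 N, ((W.filter (fun p => p.1.gcd p.2 = g)).card : ℝ) * (g * w) := by
        refine Finset.sum_congr rfl fun g _ => ?_
        rw [← nsmul_eq_mul, ← Finset.sum_const]
        refine Finset.sum_congr rfl fun p hp => ?_
        rw [(Finset.mem_filter.1 hp).2]
    _ ≤ ∑ g ∈ Finset.Icc 1 N, 650 * (2 ^ K) ^ 2 / 2 ^ t * (1 / (g : ℝ)) := by
        refine Finset.sum_le_sum fun g hg => ?_
        have hg0 : (0 : ℝ) < g := by exact_mod_cast (Finset.mem_Icc.1 hg).1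
        calc ((W.filter (fun p => p.1.gcd p.2 = g)).card : ℝ) * (g * w)
            ≤ 325 * (2 ^ K) ^ 2 * (2 ^ (K * t)) ^ 2 / (2 ^ (6 * t) * (g : ℝ) ^ 2) * (g * w) := by
              gcongr
              exact hcard g hg
          _ = _ := by
              have e : (2 : ℝ) ^ (6 * t) = 2 ^ (5 * t) * 2 ^ t := by rw [← pow_add]; ring
              rw [hw, e]
              field_simp
              norm_num
    _ = 650 * (2 ^ K) ^ 2 / 2 ^ t * ∑ g ∈ Finset.Icc 1 N, 1 / (g : ℝ) := by
        rw [Finset.mul_sum]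
    _ ≤ 650 * (2 ^ K) ^ 2 / 2 ^ t * (1 + (K * (t + 1) : ℕ)) := by
        gcongr
        exact sum_Icc_one_div_le _
    _ = _ := by push_cast; ring

theorem sum_range_linear_div_two_pow (K T : ℕ) :
    ∑ t ∈ Finset.range T, ((K * (t + 1) + 1) / 2 ^ t : ℝ) =
      K * (4 - (2 * T + 4) / 2 ^ T) + (2 - 2 / 2 ^ T) := by
  induction T with
  | zero => norm_num
  | succ T ih =>
    rw [Finset.sum_range_succ, ih, pow_succ]
    push_cast
    field_simp
    ring

theorem sum_range_pow_succ (K T : ℕ) (f : ℕ → ℝ) :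
    ∑ r ∈ Finset.range (2 ^ (K * (T + 1))), f r = ∑ r ∈ Finset.range (2 ^ (K * T)), f r +
      ∑ r ∈ Finset.Ico (2 ^ (K * T)) (2 ^ (K * (T + 1))), f r := by
  rw [Finset.range_eq_Ico, Finset.range_eq_Ico, Finset.sum_Ico_consecutive _ (Nat.zero_le _)]
  exact Nat.pow_le_pow_right (by norm_num) (Nat.mul_le_mul_left _ (Nat.le_succ T))

theorem sum_overlapError_le (β γ γ' c : ℝ) (R K t₀ T : ℕ) (δ : ℕ → ℝ) (hc : 0 < c)
    (hR : 1 ≤ R)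
    (hβ : ∀ n : ℕ, 1 ≤ n → c / (n : ℝ) ^ R ≤ ‖n • (β : UnitAddCircle)‖)
    (hγ : ∀ n : ℕ, 1 ≤ n → c / (n : ℝ) ^ R ≤ ‖n • (γ : UnitAddCircle)‖)
    (hδ : AdmissibleRadii β γ' K t₀ δ)
    (hK : (15 + 7 * R) * (R + 1) + 1 ≤ K)
    (ht₀ : ∀ t, t₀ ≤ t → 3 ≤ t ∧ 2 ^ (2 * K + 3 * R + 7) < c * 2 ^ t) :
    ∑ r ∈ Finset.range (2 ^ (K * T)), ∑ q ∈ Finset.range r, overlapError γ δ q r ≤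
      650 * (2 ^ K) ^ 2 * (4 * K + 2) := by
  have hind : ∑ r ∈ Finset.range (2 ^ (K * T)), ∑ q ∈ Finset.range r, overlapError γ δ q r ≤
      650 * (2 ^ K) ^ 2 * ∑ t ∈ Finset.range T, ((K * (t + 1) + 1) / 2 ^ t : ℝ) := by
    induction T with
    | zero => simp
    | succ T ih =>
      rw [sum_range_pow_succ, Finset.sum_range_succ, mul_add (650 * ((2 : ℝ) ^ K) ^ 2)]
      refine add_le_add ih ?_
      rcases le_or_gt t₀ T with h | h
      · exact sum_overlapError_block_le β γ γ' c R K t₀ T δ hc hR hβ hγ hδ hK (ht₀ T h).1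
          (ht₀ T h).2
      · rw [Finset.sum_eq_zero]
        · positivity
        · intro r hr
          rw [Finset.mem_Ico] at hr
          refine Finset.sum_eq_zero fun q _ => if_neg fun hov => ?_
          have := (hδ.block r T hr.1 hr.2 hov.right_pos).1
          omega
  refine hind.trans ?_
  rw [sum_range_linear_div_two_pow]
  refine mul_le_mul_of_nonneg_left ?_ (by positivity)
  have h1 : (0 : ℝ) ≤ K * ((2 * T + 4) / 2 ^ T) := by positivity
  have h2 : (0 : ℝ) ≤ 2 / 2 ^ T := by positivity
  linarith

theorem AdmissibleRadii.le_half {β γ' : ℝ} {K t₀ : ℕ} {δ : ℕ → ℝ}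
    (hδ : AdmissibleRadii β γ' K t₀ δ) (hK : 6 ≤ K) (ht₀ : 1 ≤ t₀) (q : ℕ) : δ q ≤ 1 / 2 := by
  rcases (hδ.nonneg q).eq_or_lt with h | h
  · rw [← h]; norm_num
  · have hq : 0 < q := Nat.pos_of_ne_zero (by rintro rfl; rw [hδ.zero] at h; exact lt_irrefl _ h)
    obtain ⟨s, hs1, hs2⟩ := exists_block (by omega : 0 < K) hq
    obtain ⟨h1, -, h2⟩ := hδ.block q s hs1 hs2 h
    refine h2.trans ?_
    rw [div_le_div_iff₀ (by positivity) (by norm_num), ← pow_succ, one_mul]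
    refine pow_le_pow_right₀ (by norm_num) ?_
    have : 6 * s ≤ K * s := Nat.mul_le_mul_right _ hK
    omega

theorem AdmissibleRadii.volume_nearSet {β γ' : ℝ} {K t₀ : ℕ} {δ : ℕ → ℝ}
    (hδ : AdmissibleRadii β γ' K t₀ δ) (hK : 6 ≤ K) (ht₀ : 1 ≤ t₀) (γ : UnitAddCircle) (q : ℕ) :
    volume.real (nearSet γ q (δ q)) = 2 * δ q := by
  have h0 := hδ.nonneg q
  rcases Nat.eq_zero_or_pos q with rfl | hq
  · have : nearSet γ 0 (δ 0) = ∅ := by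
      ext x
      simp [nearSet, hδ.zero]
    rw [this, hδ.zero]
    simp
  · rw [measureReal_def, _root_.volume_nearSet γ hq (hδ.le_half hK ht₀ q),
      ENNReal.toReal_ofReal (by positivity)]

theorem AdmissibleRadii.volume_inter_le {β γ' : ℝ} {K t₀ : ℕ} {δ : ℕ → ℝ}
    (hδ : AdmissibleRadii β γ' K t₀ δ) (hK : 6 ≤ K) (ht₀ : 1 ≤ t₀) (γ : ℝ) {q r : ℕ}
    (hqr : q < r) :
    volume.real (nearSet γ q (δ q) ∩ nearSet γ r (δ r)) ≤
      (2 * δ q) * (2 * δ r) + overlapError γ δ q r := by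
  unfold overlapError
  split_ifs with h
  · exact volume_nearSet_inter_le _ (by omega) (hδ.nonneg q) (hδ.nonneg r) (hδ.le_half hK ht₀ r)
  · rw [Overlapping, Set.not_nonempty_iff_eq_empty] at h
    have h1 := hδ.nonneg q
    have h2 := hδ.nonneg r
    rw [h]
    simp
    positivity

/-- The diagonal produces the term linear in the mean; the two off-diagonal halves each contribute
the bounded total error. -/
theorem sum_volume_inter_le (β γ γ' c : ℝ) (R K t₀ T : ℕ) (δ : ℕ → ℝ) (hc : 0 < c)
    (hR : 1 ≤ R)
    (hβ : ∀ n : ℕ, 1 ≤ n → c / (n : ℝ) ^ R ≤ ‖n • (β : UnitAddCircle)‖)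
    (hγ : ∀ n : ℕ, 1 ≤ n → c / (n : ℝ) ^ R ≤ ‖n • (γ : UnitAddCircle)‖)
    (hδ : AdmissibleRadii β γ' K t₀ δ)
    (hK : (15 + 7 * R) * (R + 1) + 1 ≤ K)
    (ht₀ : ∀ t, t₀ ≤ t → 3 ≤ t ∧ 2 ^ (2 * K + 3 * R + 7) < c * 2 ^ t) :
    ∑ q ∈ Finset.range (2 ^ (K * T)), ∑ r ∈ Finset.range (2 ^ (K * T)),
      volume.real (nearSet γ q (δ q) ∩ nearSet γ r (δ r)) ≤
      (∑ q ∈ Finset.range (2 ^ (K * T)), volume.real (nearSet γ q (δ q))) ^ 2 +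
      ∑ q ∈ Finset.range (2 ^ (K * T)), volume.real (nearSet γ q (δ q)) +
      2 * (650 * (2 ^ K) ^ 2 * (4 * K + 2)) := by
  have hK6 : 6 ≤ K := by nlinarith
  have ht1 : 1 ≤ t₀ := by have := (ht₀ t₀ le_rfl).1; omega
  set N := 2 ^ (K * T)
  set e : ℕ → ℕ → ℝ := fun q r => if q < r then overlapError γ δ q r else 0 with he
  have hpt : ∀ q r, volume.real (nearSet γ q (δ q) ∩ nearSet γ r (δ r)) ≤
      (2 * δ q) * (2 * δ r) + (if q = r then 2 * δ q else 0) + e q r + e r q := by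
    intro q r
    rcases lt_trichotomy q r with h | rfl | h
    · have := hδ.volume_inter_le hK6 ht1 γ h
      simp only [he, if_pos h, if_neg h.ne, if_neg h.not_gt]
      linarith
    · simp only [he, Set.inter_self, hδ.volume_nearSet hK6 ht1, if_true, lt_irrefl, if_false]
      nlinarith [hδ.nonneg q]
    · have := hδ.volume_inter_le hK6 ht1 γ h
      rw [Set.inter_comm] at this
      simp only [he, if_pos h, if_neg h.ne', if_neg h.not_gt]
      linarith
  have hesum : ∑ r ∈ Finset.range N, ∑ q ∈ Finset.range N, e q r ≤
      650 * (2 ^ K) ^ 2 * (4 * K + 2) := by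
    refine le_trans (le_of_eq ?_)
      (sum_overlapError_le β γ γ' c R K t₀ T δ hc hR hβ hγ hδ hK ht₀)
    refine Finset.sum_congr rfl fun r hr => ?_
    simp only [he]
    rw [← Finset.sum_filter]
    congr 1
    ext q
    simp only [Finset.mem_filter, Finset.mem_range] at hr ⊢
    omega
  simp only [hδ.volume_nearSet hK6 ht1]
  calc ∑ q ∈ Finset.range N, ∑ r ∈ Finset.range N,
      volume.real (nearSet γ q (δ q) ∩ nearSet γ r (δ r))
      ≤ ∑ q ∈ Finset.range N, ∑ r ∈ Finset.range N,
        ((2 * δ q) * (2 * δ r) + (if q = r then 2 * δ q else 0) + e q r + e r q) :=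
        Finset.sum_le_sum fun q _ => Finset.sum_le_sum fun r _ => hpt q r
    _ = (∑ q ∈ Finset.range N, 2 * δ q) ^ 2 + ∑ q ∈ Finset.range N, 2 * δ q +
        (∑ r ∈ Finset.range N, ∑ q ∈ Finset.range N, e q r) +
        ∑ r ∈ Finset.range N, ∑ q ∈ Finset.range N, e q r := by
        simp only [Finset.sum_add_distrib, sq, Finset.sum_mul_sum]
        congr 2
        · congr 1
          refine Finset.sum_congr rfl fun q hq => ?_
          rw [Finset.sum_ite_eq, if_pos hq]
        · exact Finset.sum_comm
    _ ≤ _ := by linarith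

end Variance

/-! ### Divergence of the sum of the radii. -/

section Mean

open MeasureTheory
open scoped Classical

/-- If `‖a - (y + 3 / 2 ^ (l + 2))‖ < 1 / 2 ^ (l + 2)` then `‖a - y‖` is of exact order `2 ^ (-l)`. -/
theorem norm_sub_mem_dyadic {a : UnitAddCircle} {y : ℝ} {l : ℕ} (hl : 1 ≤ l)
    (h : ‖a - ((y + 3 / 2 ^ (l + 2) : ℝ) : UnitAddCircle)‖ < 1 / 2 ^ (l + 2)) :
    1 / 2 ^ (l + 1) < ‖a - (y : UnitAddCircle)‖ ∧ ‖a - (y : UnitAddCircle)‖ < 1 / 2 ^ l := by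
  obtain ⟨x, rfl⟩ := QuotientAddGroup.mk_surjective a
  set u : ℝ := 1 / 2 ^ (l + 2) with hu
  have e1 : (1 : ℝ) / 2 ^ (l + 1) = 2 * u := by rw [hu]; field_simp; ring
  have e2 : (1 : ℝ) / 2 ^ l = 4 * u := by rw [hu]; field_simp; ring
  have e3 : (3 : ℝ) / 2 ^ (l + 2) = 3 * u := by rw [hu]; ring
  have hle : 4 * u ≤ 1 / 2 := by
    rw [← e2]
    apply one_div_le_one_div_of_le (by norm_num)
    calc (2 : ℝ) = 2 ^ 1 := by norm_num
      _ ≤ _ := pow_le_pow_right₀ (by norm_num) hl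
  rw [e3] at h
  rw [e1, e2]
  change ‖(x : UnitAddCircle) - _‖ < _ at h
  change _ < ‖(x : UnitAddCircle) - _‖ ∧ ‖(x : UnitAddCircle) - _‖ < _
  rw [← AddCircle.coe_sub, UnitAddCircle.norm_eq] at h
  rw [← AddCircle.coe_sub]
  set p := round (x - (y + 3 * u))
  rw [← UnitAddCircle.coe_sub_intCast _ p]
  have h' := abs_lt.1 h
  have hpos : |x - y - p| = x - y - p := abs_of_pos (by linarith)
  rw [UnitAddCircle.norm_coe_of_abs_le (by rw [hpos]; linarith), hpos]
  constructor <;> linarith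

/-- A ball of radius `2 ^ (-l - 2)` centred at `γ' + 3 · 2 ^ (-l - 2)` lies in the dyadic annulus
around `γ'`. `le_card_visits` with `H = 2 ^ (l + 3)` counts the visits to it; the rest of the block
absorbs the return time. -/
theorem card_dyadic_level_ge (β γ' c : ℝ) (R K t l : ℕ) (hc : 0 < c)
    (hβ : ∀ n : ℕ, 1 ≤ n → c / (n : ℝ) ^ R ≤ ‖n • (β : UnitAddCircle)‖)
    (hK : 5 * (R + 1) + 1 ≤ K) (ht : 2 ^ (2 * R + 4) ≤ c * 2 ^ t) (hl1 : 1 ≤ l)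
    (hl : l + 1 ≤ 5 * t) :
    (2 : ℝ) ^ (K * t) ≤ 2 ^ (l + 4) *
      ((Finset.Ico (2 ^ (K * t)) (2 ^ (K * (t + 1)))).filter (fun q : ℕ =>
        1 / 2 ^ (l + 1) < ‖q • (β : UnitAddCircle) - (γ' : UnitAddCircle)‖ ∧
        ‖q • (β : UnitAddCircle) - (γ' : UnitAddCircle)‖ < 1 / 2 ^ l)).card := by
  have hH : ((2 ^ (l + 3) : ℕ) : ℝ) = 2 ^ (l + 3) := by push_cast; rfl
  have hκ : 0 < c / ((2 : ℝ) ^ (l + 3)) ^ R := by positivity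
  have hH1 : (1 : ℝ) ≤ 2 ^ (l + 3) := one_le_pow₀ (by norm_num)
  have h := le_card_visits β (c / ((2 : ℝ) ^ (l + 3)) ^ R) (1 / 2 ^ (l + 2))
    ((γ' + 3 / 2 ^ (l + 2) : ℝ) : UnitAddCircle) (2 ^ (l + 3)) (2 ^ (K * t)) (2 ^ (K * t))
    (2 ^ (K * (t + 1))) (by positivity) hκ (by
      intro n hn1 hn2
      refine le_trans ?_ (hβ n hn1)
      have h1 : (n : ℝ) ≤ 2 ^ (l + 3) := by exact_mod_cast hn2
      have h0 : (0 : ℝ) < n := by exact_mod_cast hn1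
      gcongr) (by rw [hH, pow_succ (2 : ℝ) (l + 2)]; field_simp; norm_num) (by
      rw [hH]
      push_cast
      have h1 : ((2 : ℝ) ^ (l + 3) + 1) * (2 / (c / (2 ^ (l + 3)) ^ R)) ≤ 2 ^ (K * t) := by
        rw [div_div_eq_mul_div, mul_div_assoc', div_le_iff₀ hc]
        have hle : (2 : ℝ) ^ (l + 3) ≤ 2 ^ (5 * t + 2) :=
          pow_le_pow_right₀ (by norm_num) (by omega)
        calc ((2 : ℝ) ^ (l + 3) + 1) * (2 * (2 ^ (l + 3)) ^ R)
            ≤ (2 ^ (l + 3) + 2 ^ (l + 3)) * (2 * (2 ^ (l + 3)) ^ R) := by gcongr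
          _ = 2 ^ 2 * (2 ^ (l + 3)) ^ (R + 1) := by ring
          _ ≤ 2 ^ 2 * (2 ^ (5 * t + 2)) ^ (R + 1) := by gcongr
          _ = 2 ^ (5 * (R + 1) * t) * 2 ^ (2 * R + 4) := by
            rw [← pow_mul, ← pow_add, ← pow_add]; congr 1; ring
          _ ≤ 2 ^ (5 * (R + 1) * t) * (c * 2 ^ t) := by gcongr
          _ = 2 ^ ((5 * (R + 1) + 1) * t) * c := by
            rw [show (5 * (R + 1) + 1) * t = 5 * (R + 1) * t + t by ring, pow_add]; ring
          _ ≤ _ := by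
            have : (2 : ℝ) ^ ((5 * (R + 1) + 1) * t) ≤ 2 ^ (K * t) :=
              pow_le_pow_right₀ (by norm_num) (Nat.mul_le_mul_right _ hK)
            gcongr
      have h2 : (2 : ℝ) ^ (K * (t + 1)) = 2 ^ K * 2 ^ (K * t) := by rw [← pow_add]; ring
      have h3 : (2 : ℝ) ^ 2 ≤ 2 ^ K := pow_le_pow_right₀ (by norm_num) (by omega)
      rw [h2]
      nlinarith [(by positivity : (0 : ℝ) < 2 ^ (K * t))])
  have hsub := Finset.card_le_card (Finset.monotone_filter_right
    (Finset.Ico (2 ^ (K * t)) (2 ^ (K * (t + 1))))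
    (p := fun q : ℕ => ‖q • (β : UnitAddCircle) - ((γ' + 3 / 2 ^ (l + 2) : ℝ) : UnitAddCircle)‖
      < 1 / 2 ^ (l + 2))
    (q := fun q : ℕ => 1 / 2 ^ (l + 1) < ‖q • (β : UnitAddCircle) - (γ' : UnitAddCircle)‖ ∧
        ‖q • (β : UnitAddCircle) - (γ' : UnitAddCircle)‖ < 1 / 2 ^ l)
    (fun q _ hq => norm_sub_mem_dyadic hl1 hq))
  rw [hH] at h
  push_cast at h
  refine h.trans ?_
  have e : (2 : ℝ) ^ (l + 4) = 2 ^ (l + 3) + 2 ^ (l + 3) := by ring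
  rw [e]
  gcongr

/-- The radius `φ s / ‖q β - γ'‖` for `q` in the block number `s ≥ t₀`, if `‖q β - γ'‖` is between
`2 ^ (-5 s)` and `2 ^ (-4 s)`; otherwise zero. -/
noncomputable def radius (β γ' : ℝ) (K t₀ : ℕ) (φ : ℕ → ℝ) (q : ℕ) : ℝ :=
  if t₀ ≤ Nat.log (2 ^ K) q ∧
      1 / 2 ^ (5 * Nat.log (2 ^ K) q) ≤ ‖q • (β : UnitAddCircle) - (γ' : UnitAddCircle)‖ ∧
      ‖q • (β : UnitAddCircle) - (γ' : UnitAddCircle)‖ < 1 / 2 ^ (4 * Nat.log (2 ^ K) q)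
  then φ (Nat.log (2 ^ K) q) / ‖q • (β : UnitAddCircle) - (γ' : UnitAddCircle)‖ else 0

theorem Nat.log_two_pow_of_block {K q s : ℕ} (hs1 : 2 ^ (K * s) ≤ q)
    (hs2 : q < 2 ^ (K * (s + 1))) : Nat.log (2 ^ K) q = s :=
  Nat.log_eq_of_pow_le_of_lt_pow (by rwa [← pow_mul]) (by rwa [← pow_mul])

theorem radius_of_block {β γ' : ℝ} {K t₀ : ℕ} {φ : ℕ → ℝ} {q s : ℕ} (hs1 : 2 ^ (K * s) ≤ q)
    (hs2 : q < 2 ^ (K * (s + 1))) : radius β γ' K t₀ φ q =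
      if t₀ ≤ s ∧ 1 / 2 ^ (5 * s) ≤ ‖q • (β : UnitAddCircle) - (γ' : UnitAddCircle)‖ ∧
        ‖q • (β : UnitAddCircle) - (γ' : UnitAddCircle)‖ < 1 / 2 ^ (4 * s)
      then φ s / ‖q • (β : UnitAddCircle) - (γ' : UnitAddCircle)‖ else 0 := by
  unfold radius
  rw [Nat.log_two_pow_of_block hs1 hs2]

theorem admissibleRadii_radius (β γ' : ℝ) {K t₀ : ℕ} {φ : ℕ → ℝ} (ht₀ : 1 ≤ t₀)
    (hφ0 : ∀ s, 0 ≤ φ s) (hφ1 : ∀ s, φ s ≤ 1 / 2 ^ (K * s)) :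
    AdmissibleRadii β γ' K t₀ (radius β γ' K t₀ φ) where
  nonneg q := by
    unfold radius
    split_ifs
    · exact div_nonneg (hφ0 _) (norm_nonneg _)
    · exact le_rfl
  zero := by
    unfold radius
    rw [if_neg]
    -- The logarithm of `0` is `0` by convention, which is below `t₀`.
    rw [Nat.log_zero_right]
    omega
  block q s hs1 hs2 hpos := by
    rw [radius_of_block hs1 hs2] at hpos ⊢
    split_ifs at hpos ⊢ with h
    · refine ⟨h.1, h.2.2, ?_⟩
      have h0 : (0 : ℝ) < 1 / 2 ^ (5 * s) := by positivity
      calc φ s / ‖q • (β : UnitAddCircle) - (γ' : UnitAddCircle)‖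
          ≤ (1 / 2 ^ (K * s)) / (1 / 2 ^ (5 * s)) :=
            div_le_div₀ (by positivity) (hφ1 s) h0 h.2.1
        _ = _ := by field_simp
    · exact (lt_irrefl _ hpos).elim

/-- At level `l` there are at least `2 ^ (K t - l - 4)` integers, each of radius at least `2 ^ l φ
t`, so the contribution does not depend on `l`. The factor `t` counts the disjoint levels `4 t ≤ l <
5 t`. -/
theorem sum_radius_block_ge (β γ' c : ℝ) (R K t₀ t : ℕ) (φ : ℕ → ℝ) (hc : 0 < c)
    (hβ : ∀ n : ℕ, 1 ≤ n → c / (n : ℝ) ^ R ≤ ‖n • (β : UnitAddCircle)‖)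
    (hK : 5 * (R + 1) + 1 ≤ K) (ht : 2 ^ (2 * R + 4) ≤ c * 2 ^ t) (ht₀ : t₀ ≤ t) (ht1 : 1 ≤ t)
    (hφ0 : ∀ s, 0 ≤ φ s) :
    t * 2 ^ (K * t) * φ t / 16 ≤
      ∑ q ∈ Finset.Ico (2 ^ (K * t)) (2 ^ (K * (t + 1))), radius β γ' K t₀ φ q := by
  set I := Finset.Ico (2 ^ (K * t)) (2 ^ (K * (t + 1))) with hI
  set ν : ℕ → ℝ := fun q => ‖q • (β : UnitAddCircle) - (γ' : UnitAddCircle)‖ with hν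
  set L : ℕ → Finset ℕ := fun l => I.filter (fun q => 1 / 2 ^ (l + 1) < ν q ∧ ν q < 1 / 2 ^ l)
    with hL
  have hanti : ∀ i j : ℕ, i ≤ j → (1 : ℝ) / 2 ^ j ≤ 1 / 2 ^ i := fun i j hij =>
    one_div_le_one_div_of_le (by positivity) (pow_le_pow_right₀ (by norm_num) hij)
  have hdisj : (↑(Finset.Ico (4 * t) (5 * t)) : Set ℕ).PairwiseDisjoint L := by
    have key : ∀ i j : ℕ, i < j → Disjoint (L i) (L j) := by
      intro i j hij
      rw [Finset.disjoint_left]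
      intro q hq hq'
      have h1 := (Finset.mem_filter.1 hq).2.1
      have h2 := (Finset.mem_filter.1 hq').2.2
      linarith [hanti (i + 1) j hij]
    intro i _ j _ hij
    rcases lt_or_gt_of_ne hij with h | h
    · exact key i j h
    · exact (key j i h).symm
  have hr : ∀ l ∈ Finset.Ico (4 * t) (5 * t), ∀ q ∈ L l, 2 ^ l * φ t ≤ radius β γ' K t₀ φ q := by
    intro l hl q hq
    rw [Finset.mem_Ico] at hl
    obtain ⟨hqI, hq1, hq2⟩ := Finset.mem_filter.1 hq
    rw [hI, Finset.mem_Ico] at hqI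
    have h0 : 0 < ν q := lt_trans (by positivity) hq1
    rw [radius_of_block hqI.1 hqI.2, if_pos ⟨ht₀, (hanti (l + 1) (5 * t) (by omega)).trans hq1.le,
      hq2.trans_le (hanti (4 * t) l hl.1)⟩]
    change _ ≤ φ t / ν q
    rw [le_div_iff₀ h0]
    have h1 : 2 ^ l * ν q ≤ 1 := by
      rw [lt_div_iff₀ (by positivity)] at hq2
      linarith
    nlinarith [hφ0 t]
  have hrad0 : ∀ q, 0 ≤ radius β γ' K t₀ φ q := by
    intro q
    unfold radius
    split_ifs
    · exact div_nonneg (hφ0 _) (norm_nonneg _)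
    · exact le_rfl
  calc (t : ℝ) * 2 ^ (K * t) * φ t / 16
      = ∑ l ∈ Finset.Ico (4 * t) (5 * t), 2 ^ (K * t) * φ t / 16 := by
        rw [Finset.sum_const, Nat.card_Ico, show 5 * t - 4 * t = t by omega, nsmul_eq_mul]
        ring
    _ ≤ ∑ l ∈ Finset.Ico (4 * t) (5 * t), ∑ q ∈ L l, radius β γ' K t₀ φ q := by
        refine Finset.sum_le_sum fun l hl => ?_
        have hl' := Finset.mem_Ico.1 hl
        have hcard := card_dyadic_level_ge β γ' c R K t l hc hβ hK ht (by omega) (by omega)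
        calc (2 : ℝ) ^ (K * t) * φ t / 16 ≤ (2 ^ (l + 4) * (L l).card) * φ t / 16 := by
              have := hφ0 t
              gcongr
          _ = ∑ q ∈ L l, 2 ^ l * φ t := by
              rw [Finset.sum_const, nsmul_eq_mul]; ring
          _ ≤ _ := Finset.sum_le_sum (hr l hl)
    _ = ∑ q ∈ (Finset.Ico (4 * t) (5 * t)).biUnion L, radius β γ' K t₀ φ q :=
        (Finset.sum_biUnion hdisj).symm
    _ ≤ _ := by
        refine Finset.sum_le_sum_of_subset_of_nonneg ?_ fun q _ _ => hrad0 q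
        intro q hq
        obtain ⟨l, -, hq'⟩ := Finset.mem_biUnion.1 hq
        exact (Finset.mem_filter.1 hq').1

/-- Condensation: divergence of `∑ ψ(q) log q` gives divergence along the blocks. -/
theorem not_summable_condensed (ψ : ℕ → ℝ) (K : ℕ) (hK : 0 < K)
    (hψ_nonneg : ∀ q : ℕ, 1 ≤ q → 0 ≤ ψ q)
    (hψ_anti : ∀ q r : ℕ, 1 ≤ q → q ≤ r → ψ r ≤ ψ q)
    (hψ_div : Filter.Tendsto (fun N : ℕ => ∑ q ∈ Finset.Icc 1 N, ψ q * Real.log q)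
      Filter.atTop Filter.atTop) :
    ¬ Summable (fun t : ℕ => (t : ℝ) * 2 ^ (K * t) * ψ (2 ^ (K * (t + 1)))) := by
  intro hs
  have hpow1 : ∀ n : ℕ, 1 ≤ 2 ^ n := fun n => Nat.one_le_two_pow
  have hu0 : ∀ t : ℕ, 0 ≤ (t : ℝ) * 2 ^ (K * t) * ψ (2 ^ (K * (t + 1))) := fun t =>
    mul_nonneg (by positivity) (hψ_nonneg _ (hpow1 _))
  have hf0 : ∀ q : ℕ, 1 ≤ q → 0 ≤ ψ q * Real.log q := fun q hq =>
    mul_nonneg (hψ_nonneg q hq) (Real.log_natCast_nonneg q)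
  set D : ℝ := 2 ^ (2 * K) * (3 * K) with hD
  -- The left endpoint of this block is where term `t + 1` of the condensed series evaluates `ψ`.
  -- The shift keeps that term's weight nonzero, so `K (t + 3) ≤ 3 K (t + 1)` bounds the logarithm;
  -- earlier blocks go into `G 0`.
  have hblock : ∀ t : ℕ, ∑ q ∈ Finset.Ico (2 ^ (K * (t + 2))) (2 ^ (K * (t + 3))),
      ψ q * Real.log q ≤
      D * (((t + 1 : ℕ) : ℝ) * 2 ^ (K * (t + 1)) * ψ (2 ^ (K * (t + 1 + 1)))) := by
    intro t
    have hψ0 := hψ_nonneg (2 ^ (K * (t + 2))) (hpow1 _)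
    have hterm : ∀ q ∈ Finset.Ico (2 ^ (K * (t + 2))) (2 ^ (K * (t + 3))),
        ψ q * Real.log q ≤ ψ (2 ^ (K * (t + 2))) * (3 * K * (t + 1)) := by
      intro q hq
      rw [Finset.mem_Ico] at hq
      have hq1 : 1 ≤ q := (hpow1 _).trans hq.1
      have hlog : Real.log q ≤ 3 * K * (t + 1) := by
        have h1 : Real.log q ≤ Real.log ((2 : ℝ) ^ (K * (t + 3))) := by
          apply Real.log_le_log (by exact_mod_cast hq1)
          exact_mod_cast hq.2.le
        rw [Real.log_pow] at h1
        have h2 : Real.log 2 ≤ 1 := by linarith [Real.log_two_lt_d9]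
        have h3 : ((K * (t + 3) : ℕ) : ℝ) * Real.log 2 ≤ ((K * (t + 3) : ℕ) : ℝ) * 1 := by gcongr
        push_cast at h1 h3
        nlinarith [(by positivity : (0 : ℝ) ≤ K * t)]
      exact mul_le_mul (hψ_anti _ _ (hpow1 _) hq.1) hlog (Real.log_natCast_nonneg q) hψ0
    have hcard : ((2 ^ (K * (t + 3)) - 2 ^ (K * (t + 2)) : ℕ) : ℝ) ≤ 2 ^ (K * (t + 3)) := by
      exact_mod_cast Nat.sub_le _ _
    calc ∑ q ∈ Finset.Ico (2 ^ (K * (t + 2))) (2 ^ (K * (t + 3))), ψ q * Real.log q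
        ≤ ((2 ^ (K * (t + 3)) - 2 ^ (K * (t + 2)) : ℕ) : ℝ) *
          (ψ (2 ^ (K * (t + 2))) * (3 * K * (t + 1))) := by
          refine (Finset.sum_le_card_nsmul _ _ _ hterm).trans (le_of_eq ?_)
          rw [Nat.card_Ico, nsmul_eq_mul]
      _ ≤ 2 ^ (K * (t + 3)) * (ψ (2 ^ (K * (t + 2))) * (3 * K * (t + 1))) := by gcongr
      _ = _ := by
          have e : (2 : ℝ) ^ (K * (t + 3)) = 2 ^ (2 * K) * 2 ^ (K * (t + 1)) := by
            rw [← pow_add]; congr 1; ring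
          rw [e, hD]
          push_cast
          ring
  set G : ℕ → ℝ := fun T => ∑ q ∈ Finset.Ico 1 (2 ^ (K * (T + 2))), ψ q * Real.log q with hG
  set U := ∑' t : ℕ, (t : ℝ) * 2 ^ (K * t) * ψ (2 ^ (K * (t + 1))) with hU
  have hGle : ∀ T, G T ≤ G 0 + D * ∑ t ∈ Finset.range T,
      (((t + 1 : ℕ) : ℝ) * 2 ^ (K * (t + 1)) * ψ (2 ^ (K * (t + 1 + 1)))) := by
    intro T
    induction T with
    | zero => simp
    | succ T ih =>
      have e : G (T + 1) = G T + ∑ q ∈ Finset.Ico (2 ^ (K * (T + 2))) (2 ^ (K * (T + 3))),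
          ψ q * Real.log q :=
        (Finset.sum_Ico_consecutive _ (hpow1 _) (Nat.pow_le_pow_right (by norm_num)
          (Nat.mul_le_mul_left _ (by omega)))).symm
      rw [e, Finset.sum_range_succ, mul_add D]
      linarith [hblock T]
  have hbound : ∀ N : ℕ, ∑ q ∈ Finset.Icc 1 N, ψ q * Real.log q ≤ G 0 + D * U := by
    intro N
    have hN : N < 2 ^ (K * (N + 2)) := by
      refine Nat.lt_two_pow_self.trans_le (Nat.pow_le_pow_right (by norm_num) ?_)
      nlinarith
    calc ∑ q ∈ Finset.Icc 1 N, ψ q * Real.log q ≤ G N := by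
          refine Finset.sum_le_sum_of_subset_of_nonneg ?_ ?_
          · intro q hq
            rw [Finset.mem_Icc] at hq
            rw [Finset.mem_Ico]
            omega
          · intro q hq _
            exact hf0 q (Finset.mem_Ico.1 hq).1
      _ ≤ _ := hGle N
      _ ≤ G 0 + D * U := by
          have h1 := hs.sum_le_tsum (Finset.range (N + 1)) fun t _ => hu0 t
          rw [Finset.sum_range_succ'] at h1
          have h2 := hu0 0
          have hD0 : 0 ≤ D := by positivity
          gcongr
          linarith
  obtain ⟨N, hN⟩ := (hψ_div.eventually_gt_atTop (G 0 + D * U)).exists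
  exact absurd (hbound N) (not_le.2 hN)

/-- Truncating the terms of a divergent series at `t` preserves divergence. -/
theorem not_summable_truncated {u : ℕ → ℝ} (hu : ¬ Summable u) :
    ¬ Summable (fun t : ℕ => min (u t) t) := by
  intro hs
  apply hu
  -- Once the minimum is below `1 ≤ t`, it must be `u t`.
  have h1 : ∀ᶠ t in Filter.atTop, min (u t) (t : ℝ) < 1 :=
    hs.tendsto_atTop_zero.eventually_lt_const zero_lt_one
  refine hs.congr_atTop ?_
  filter_upwards [h1, Filter.eventually_ge_atTop 1] with t ht ht1
  have : (1 : ℝ) ≤ t := by exact_mod_cast ht1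
  rcases min_choice (u t) (t : ℝ) with h | h
  · exact h
  · rw [h] at ht
    linarith

end Mean

/-! ### Passage to the circle and to integer exponents. -/

theorem distInt_eq_norm (x : ℝ) : distInt x = ‖(x : UnitAddCircle)‖ := by
  rw [UnitAddCircle.norm_eq, distInt]

/-- Set one of the two coefficients to zero and round `ρ` up to an integer. -/
theorem IsDiophantinePair.exists_pow_bound {γ β : ℝ} (h : IsDiophantinePair γ β) :
    ∃ (R : ℕ) (c : ℝ), 1 ≤ R ∧ 0 < c ∧
      (∀ n : ℕ, 1 ≤ n → c / (n : ℝ) ^ R ≤ ‖n • (γ : UnitAddCircle)‖) ∧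
      ∀ n : ℕ, 1 ≤ n → c / (n : ℝ) ^ R ≤ ‖n • (β : UnitAddCircle)‖ := by
  obtain ⟨-, ρ, c, hρ, hc, hd⟩ := h
  have hpow : ∀ n : ℕ, 1 ≤ n → c / (n : ℝ) ^ ⌈ρ⌉₊ ≤ c * (n : ℝ) ^ (-ρ) := by
    intro n hn
    have hn' : (1 : ℝ) ≤ n := by exact_mod_cast hn
    rw [Real.rpow_neg (by positivity), ← div_eq_mul_inv, ← Real.rpow_natCast]
    gcongr
    exact Nat.le_ceil ρ
  refine ⟨⌈ρ⌉₊, c, Nat.one_le_iff_ne_zero.2 (Nat.ceil_pos.2 hρ).ne', hc, ?_, ?_⟩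
  · intro n hn
    have := hd n 0 (Or.inl (by omega))
    rw [distInt_eq_norm] at this
    simp only [Int.cast_natCast, Int.cast_zero, abs_zero, zero_mul, add_zero, Nat.abs_cast,
      Nat.cast_nonneg, sup_of_le_left, UnitAddCircle.coe_natCast_mul] at this
    exact (hpow n hn).trans this
  · intro n hn
    have := hd 0 n (Or.inr (by omega))
    rw [distInt_eq_norm] at this
    simp only [Int.cast_natCast, Int.cast_zero, abs_zero, zero_mul, zero_add, Nat.abs_cast,
      Nat.cast_nonneg, sup_of_le_right, UnitAddCircle.coe_natCast_mul] at this
    exact (hpow n hn).trans this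

/-! ### Assembly of mean and variance, and return to the interval. -/

section Main

open MeasureTheory

theorem ae_infinite_mem_nearSet_radius (β γ γ' c : ℝ) (R K t₀ : ℕ) (φ : ℕ → ℝ) (hc : 0 < c)
    (hR : 1 ≤ R)
    (hβ : ∀ n : ℕ, 1 ≤ n → c / (n : ℝ) ^ R ≤ ‖n • (β : UnitAddCircle)‖)
    (hγ : ∀ n : ℕ, 1 ≤ n → c / (n : ℝ) ^ R ≤ ‖n • (γ : UnitAddCircle)‖)
    (hK : (15 + 7 * R) * (R + 1) + 1 ≤ K)
    (ht₀ : ∀ t, t₀ ≤ t → 3 ≤ t ∧ 2 ^ (2 * K + 3 * R + 7) < c * 2 ^ t)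
    (hφ0 : ∀ s, 0 ≤ φ s) (hφ1 : ∀ s, φ s ≤ 1 / 2 ^ (K * s))
    (hφ : ¬ Summable (fun t : ℕ => (t : ℝ) * 2 ^ (K * t) * φ t)) :
    ∀ᵐ x : UnitAddCircle, {q | x ∈ nearSet γ q (radius β γ' K t₀ φ q)}.Infinite := by
  have : IsProbabilityMeasure (volume : Measure UnitAddCircle) := ⟨UnitAddCircle.measure_univ⟩
  have hK6 : 6 ≤ K := by nlinarith
  have ht1 : 1 ≤ t₀ := by have := (ht₀ t₀ le_rfl).1; omega
  have hδ := admissibleRadii_radius β γ' ht1 hφ0 hφ1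
  set δ := radius β γ' K t₀ φ with hδdef
  refine ae_infinite_of_sum_inter_le volume (fun q => nearSet γ q (δ q))
    (fun q => measurableSet_nearSet _ _ _) (fun n => Finset.range (2 ^ (K * (n + t₀)))) _ ?_
    (fun n => sum_volume_inter_le β γ γ' c R K t₀ (n + t₀) δ hc hR hβ hγ hδ hK ht₀)
  simp only [hδ.volume_nearSet hK6 ht1]
  have hv0 : ∀ t : ℕ, 0 ≤ (t : ℝ) * 2 ^ (K * t) * φ t := fun t =>
    mul_nonneg (by positivity) (hφ0 t)
  have hdiv := (not_summable_iff_tendsto_nat_atTop_of_nonneg fun i => hv0 (i + t₀)).1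
    fun h => hφ ((summable_nat_add_iff t₀).1 h)
  -- Each set has measure twice its radius, so the `1 / 16` of `sum_radius_block_ge` becomes `1 /
  -- 8`.
  refine Filter.tendsto_atTop_mono (fun n => ?_)
    (hdiv.const_mul_atTop (by norm_num : (0 : ℝ) < 1 / 8))
  rw [← Finset.mul_sum]
  induction n with
  | zero =>
    simp only [Finset.range_zero, Finset.sum_empty, mul_zero]
    exact mul_nonneg (by norm_num) (Finset.sum_nonneg fun q _ => hδ.nonneg q)
  | succ n ih =>
    have hb := sum_radius_block_ge β γ' c R K t₀ (n + t₀) φ hc hβ (by nlinarith)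
      (le_trans (pow_le_pow_right₀ (by norm_num) (by omega)) (ht₀ (n + t₀) (by omega)).2.le)
      (by omega) (by omega) hφ0
    rw [show n + 1 + t₀ = n + t₀ + 1 by ring, sum_range_pow_succ, Finset.sum_range_succ]
    linarith

theorem theorem1p2 (ψ : ℕ → ℝ) (hψ_nonneg : ∀ q : ℕ, 1 ≤ q → 0 ≤ ψ q)
    (hψ_anti : ∀ q r : ℕ, 1 ≤ q → q ≤ r → ψ r ≤ ψ q)
    (hψ_div : Filter.Tendsto (fun N : ℕ => ∑ q ∈ Finset.Icc 1 N, ψ q * Real.log q)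
      Filter.atTop Filter.atTop)
    (γ β : ℝ) (hγ : Irrational γ) (hβ : Irrational β) (hγβ : IsDiophantinePair γ β)
    (γ' : ℝ) :
    MeasureTheory.volume (fibredSet ψ β γ γ') = 1 := by
  obtain ⟨R, c, hR, hc, hγd, hβd⟩ := hγβ.exists_pow_bound
  -- `15 + 7 R` is the gcd threshold exponent `11 + 7 R` plus `4` for the finest visit scale `2 ^
  -- (-4 t)`. The power `R + 1` comes from the counting error, and the final `1` absorbs `c`.
  set K := (15 + 7 * R) * (R + 1) + 1 with hK
  have hlim : Filter.Tendsto (fun t : ℕ => c * (2 : ℝ) ^ t) Filter.atTop Filter.atTop :=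
    (tendsto_pow_atTop_atTop_of_one_lt (by norm_num)).const_mul_atTop hc
  obtain ⟨t₀, ht₀⟩ := Filter.eventually_atTop.1 ((Filter.eventually_ge_atTop 3).and
    (hlim.eventually_gt_atTop (2 ^ (2 * K + 3 * R + 7))))
  -- The first entry keeps `φ` below `ψ` throughout the block, by monotonicity; the second makes the
  -- radii admissible. After weighting by `t 2 ^ (K t)`, the cap is truncation at `t`.
  set φ : ℕ → ℝ := fun t => min (ψ (2 ^ (K * (t + 1)))) (1 / 2 ^ (K * t)) with hφdef
  have hφ : ¬ Summable (fun t : ℕ => (t : ℝ) * 2 ^ (K * t) * φ t) := by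
    have h := not_summable_truncated
      (not_summable_condensed ψ K (by omega) hψ_nonneg hψ_anti hψ_div)
    have e : ∀ t : ℕ, (t : ℝ) * 2 ^ (K * t) * φ t =
        min ((t : ℝ) * 2 ^ (K * t) * ψ (2 ^ (K * (t + 1)))) t := by
      intro t
      rw [hφdef, mul_min_of_nonneg _ _ (by positivity)]
      congr 1
      field_simp
    simpa only [e] using h
  have hae := ae_infinite_mem_nearSet_radius β γ γ' c R K t₀ φ hc hR hβd hγd le_rfl ht₀
    (fun s => le_min (hψ_nonneg _ Nat.one_le_two_pow) (by positivity))
    (fun s => min_le_right _ _) hφ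
  -- The quotient map from `(0, 1]` preserves measure, so the almost-everywhere statement pulls back
  -- to the line.
  have hae' := (UnitAddCircle.measurePreserving_mk 0).quasiMeasurePreserving.ae hae
  have hsub : ∀ᵐ x : ℝ ∂(volume.restrict (Set.Ioc 0 (0 + 1))), x ∈ fibredSet ψ β γ γ' := by
    filter_upwards [hae', ae_restrict_mem measurableSet_Ioc] with x hx hxI
    rw [zero_add] at hxI
    refine ⟨Set.Ioc_subset_Icc_self hxI, hx.mono fun q hq => ?_⟩
    have hq' : ‖q • (x : UnitAddCircle) - (γ : UnitAddCircle)‖ < radius β γ' K t₀ φ q := hq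
    unfold radius at hq'
    split_ifs at hq' with hcond
    · have hq0 : q ≠ 0 := by
        rintro rfl
        rw [Nat.log_zero_right] at hcond
        have := (ht₀ t₀ le_rfl).1
        omega
      have hν : 0 < ‖q • (β : UnitAddCircle) - (γ' : UnitAddCircle)‖ :=
        lt_of_lt_of_le (by positivity) hcond.2.1
      rw [lt_div_iff₀ hν] at hq'
      refine ⟨Nat.one_le_iff_ne_zero.2 hq0, ?_⟩
      rw [distInt_eq_norm, distInt_eq_norm, AddCircle.coe_sub, AddCircle.coe_sub,
        UnitAddCircle.coe_natCast_mul, UnitAddCircle.coe_natCast_mul]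
      refine hq'.trans_le ((min_le_left _ _).trans ?_)
      refine hψ_anti _ _ (Nat.one_le_iff_ne_zero.2 hq0) ?_
      rw [pow_mul]
      exact (Nat.lt_pow_succ_log_self (Nat.one_lt_two_pow (by omega)) q).le
    · exact absurd hq' (not_lt.2 (norm_nonneg _))
  apply le_antisymm
  · calc volume (fibredSet ψ β γ γ') ≤ volume (Set.Icc (0 : ℝ) 1) := measure_mono fun x hx => hx.1
      _ = 1 := by simp
  · have h1 : volume (Set.Ioc (0 : ℝ) 1) ≤ volume (fibredSet ψ β γ γ') := by
      rw [zero_add, ae_restrict_iff' measurableSet_Ioc] at hsub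
      exact measure_mono_ae hsub
    simpa using h1

end Main
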